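/- Let $S\subset\mathbb R^2$ be a compact convex set with non-empty interior whose boundary $\partial S$ is a $C^2$ curve (a simple closed curve with a regular $C^2$ parametrization). Let the visibility domain $V_S$ be the set of all pairs $(p,v)$, where $p\in\mathbb R^2\setminus\operatorname{int}(S)$ and $v$ is a unit vector, such that the ray from $p$ in the direction $v$ meets $S$. The bouncing outer billiard map $F\colon V_S\to V_S$, $F(p,v)=(p',v')$, is defined as follows. Let $w$ be the first point of $S$ on the ray from $p$ in the direction $v$; let $R'$ be the ray starting at $w$ whose direction $r$ is the reflection of $v$ in the tangent line to $\partial S$ at $w$ (the angle of incidence equals the angle of reflection); let $p'\in R'$ be the point with $\|p'-w\|=\|p-w\|$; and let $v'$ be the reflection of $u=-r$ (the direction from $p'$ to $w$) across the bisector of the angle formed by the two rays from $p'$ that are tangent to $S$ (when $p'\in\partial S$, these rays are opposite and the bisector is the normal line to $\partial S$ at $p'$). Then $F$ does map $V_S$ into itself, and the restriction to $V_S$ of the measure $dA\otimes d\theta$, where $dA$ is the Lebesgue measure on $\mathbb R^2$ and $d\theta$ is the Lebesgue measure on the circle of unit vectors, is an infinite measure that is invariant under $F$. -/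

import Mathlib

open MeasureTheory Set

noncomputable section

/-- The Euclidean plane `ℝ²`. -/
abbrev Plane : Type := EuclideanSpace ℝ (Fin 2)

/-- The circle of unit vectors of the plane. -/
abbrev UnitVec : Type := Metric.sphere (0 : Plane) 1

/-- `Γ` is a simple closed regular curve of class `C²` in the plane: it is traced out once per
period by a periodic `C²` parametrization with nowhere vanishing velocity. -/
def IsSimpleClosedC2Curve (Γ : Set Plane) : Prop :=
  ∃ (γ : ℝ → Plane) (L : ℝ), 0 < L ∧ ContDiff ℝ 2 γ ∧ Function.Periodic γ L ∧
    InjOn γ (Ico 0 L) ∧ (∀ s, deriv γ s ≠ 0) ∧ range γ = Γ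

/-- The unit vector `(cos θ, sin θ)`. -/
def unitVec (θ : ℝ) : UnitVec :=
  ⟨!₂[Real.cos θ, Real.sin θ], by
    simp [EuclideanSpace.norm_eq]⟩

/-- The Lebesgue measure `dθ` on the circle of unit vectors (of total mass `2π`). -/
def circleMeasure : Measure UnitVec :=
  (volume.restrict (Ioc (0 : ℝ) (2 * Real.pi))).map unitVec

/-- The measure `dA ⊗ dθ` on the unit tangent bundle of the plane. -/
def phaseMeasure : Measure (Plane × UnitVec) :=
  (volume : Measure Plane).prod circleMeasure

/-- The visibility domain `V_S`: pairs `(p, v)`, with `p` not interior to `S`, such that the ray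
from `p` in the direction of the unit vector `v` meets `S`. -/
def visibilityDomain (S : Set Plane) : Set (Plane × UnitVec) :=
  {z | z.1 ∉ interior S ∧ ∃ t : ℝ, 0 ≤ t ∧ z.1 + t • (z.2 : Plane) ∈ S}

/-- The restriction of `dA ⊗ dθ` to `V_S`, as a measure on `V_S`. -/
def visibilityMeasure (S : Set Plane) : Measure (visibilityDomain S) :=
  phaseMeasure.comap Subtype.val

/-- The bounce point `w`: the first point of `S` on the ray from `p` in the direction `v`. -/
def bouncePoint (S : Set Plane) (p v : Plane) : Plane :=
  p + sInf {t : ℝ | 0 ≤ t ∧ p + t • v ∈ S} • v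

/-- The direction of the tangent line at the boundary point `w` of a convex set `S`, as a linear
subspace: the vectors orthogonal to all outward normals of `S` at `w`. (Where the boundary is
`C¹` the outward normals form a single ray, so that this is a line.) -/
def tangentLine (S : Set Plane) (w : Plane) : Submodule ℝ Plane :=
  (Submodule.span ℝ {n : Plane | ∀ x ∈ S, inner ℝ n (x - w) ≤ 0})ᗮ

/-- The ray from `p` in the direction of the unit vector `d` is tangent to the convex body `S`:
it meets `S`, and its line does not enter the interior of `S`. -/
def IsTangentDir (S : Set Plane) (p d : Plane) : Prop :=
  ‖d‖ = 1 ∧ (∃ t : ℝ, 0 ≤ t ∧ p + t • d ∈ S) ∧ ∀ t : ℝ, p + t • d ∉ interior S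

/-- The direction of the bisector of the angle between the two rays from `p` tangent to `S`, as a
linear subspace: the vectors that make equal angles with the directions of these rays. (If `p` is
a boundary point, these directions are opposite and the bisector is the normal line.) -/
def bisectorLine (S : Set Plane) (p : Plane) : Submodule ℝ Plane where
  carrier := {x | ∀ h k : Plane, IsTangentDir S p h → IsTangentDir S p k →
    inner ℝ h x = inner ℝ k x}
  add_mem' := by
    intro x y hx hy h k hh hk
    rw [inner_add_right, inner_add_right, hx h k hh hk, hy h k hh hk]
  zero_mem' := by
    intro h k _ _
    rw [inner_zero_right, inner_zero_right]
  smul_mem' := by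
    intro c x hx h k hh hk
    rw [inner_smul_right, inner_smul_right, hx h k hh hk]

/-- The direction of the ray reflected at `w`: angle of incidence equals angle of reflection. -/
def reflectedDir (S : Set Plane) (p v : Plane) : Plane :=
  (tangentLine S (bouncePoint S p v)).reflection v

/-- The point `p'` on the reflected ray with `‖p' - w‖ = ‖p - w‖`. -/
def nextPoint (S : Set Plane) (p v : Plane) : Plane :=
  bouncePoint S p v + dist p (bouncePoint S p v) • reflectedDir S p v

/-- The direction `v'`: the reflection of the direction `u` from `p'` back to `w` (opposite to the
reflected ray) across the bisector of the angle between the two rays from `p'` tangent to `S`. -/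
def nextDir (S : Set Plane) (p v : Plane) : Plane :=
  (bisectorLine S (nextPoint S p v)).reflection (-reflectedDir S p v)

theorem norm_nextDir (S : Set Plane) (p v : Plane) : ‖nextDir S p v‖ = ‖v‖ := by
  simp only [nextDir, reflectedDir, LinearIsometryEquiv.norm_map, norm_neg]

/-- The bouncing outer billiard map `F_S`. It is meaningful on the visibility domain of `S`. -/
def bouncingOuterBilliard (S : Set Plane) (z : Plane × UnitVec) : Plane × UnitVec :=
  (nextPoint S z.1 z.2, ⟨nextDir S z.1 z.2, by
    rw [mem_sphere_zero_iff_norm, norm_nextDir]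
    exact mem_sphere_zero_iff_norm.1 z.2.2⟩)

end

open MeasureTheory Set

/-! On `V_S` the map factors as `bisectorMap ∘ bounceMap` (`bouncingOuterBilliard_eq`): first `(p,
v)` goes to `(p', u)`, then `u` is reflected across the bisector at `p'`. Each factor preserves
`V_S` and the measure.

The second factor fixes the base point and acts on each circle of directions by a reflection, so it
preserves `dA ⊗ dθ` fibrewise. It preserves `V_S` because, for a base point outside `S`, it swaps
the two tangent rays and hence preserves the cone of directions between them.

For the first factor, describe a ray by its arrival data: `p = γ s - t • v` (`rayMap`). For fixed
`v` the Jacobian is `|det2 (γ' s) v|`, so the measure becomes `|det2 (γ' s) v| ds dt dθ`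
(`phaseMeasure_inter`). Here the bounce keeps `s` and `t` and reflects `v` in the normal at `γ s`
(`bounceMap_rayMap`); this preserves both `dθ` and `det2 (γ' s) v`. Points of `∂S` and rays whose
line misses the interior are not covered, but form null sets.

The measure is infinite because, for every direction, infinitely many disjoint balls of equal size
see `S`. -/

/-! ### Plane determinants -/

/-- The determinant of two plane vectors. -/
def det2 (x y : Plane) : ℝ := x 0 * y 1 - x 1 * y 0

theorem inner_plane (x y : Plane) : inner ℝ x y = x 0 * y 0 + x 1 * y 1 := by
  simp [PiLp.inner_apply, Fin.sum_univ_two, mul_comm]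

theorem plane_ext {x y : Plane} (h0 : x 0 = y 0) (h1 : x 1 = y 1) : x = y := by
  ext i; fin_cases i <;> assumption

theorem plane_eq_zero_iff {x : Plane} : x = 0 ↔ x 0 = 0 ∧ x 1 = 0 :=
  ⟨fun h => by simp [h], fun h => plane_ext (by simpa using h.1) (by simpa using h.2)⟩

theorem inner_self_plane_pos {x : Plane} (hx : x ≠ 0) : 0 < inner ℝ x x :=
  real_inner_self_pos.2 hx

@[simp] theorem det2_self (x : Plane) : det2 x x = 0 := by simp only [det2]; ring

theorem det2_swap (x y : Plane) : det2 y x = -det2 x y := by simp only [det2]; ring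

@[simp] theorem det2_add_right (x y z : Plane) : det2 x (y + z) = det2 x y + det2 x z := by
  simp only [det2, PiLp.add_apply]; ring

@[simp] theorem det2_sub_right (x y z : Plane) : det2 x (y - z) = det2 x y - det2 x z := by
  simp only [det2, PiLp.sub_apply]; ring

@[simp] theorem det2_smul_right (x y : Plane) (c : ℝ) : det2 x (c • y) = c * det2 x y := by
  simp only [det2, PiLp.smul_apply, smul_eq_mul]; ring

@[simp] theorem det2_neg_right (x y : Plane) : det2 x (-y) = -det2 x y := by
  simp only [det2, PiLp.neg_apply]; ring

@[simp] theorem det2_add_left (x y z : Plane) : det2 (x + y) z = det2 x z + det2 y z := by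
  simp only [det2, PiLp.add_apply]; ring

@[simp] theorem det2_smul_left (x y : Plane) (c : ℝ) : det2 (c • x) y = c * det2 x y := by
  simp only [det2, PiLp.smul_apply, smul_eq_mul]; ring

@[simp] theorem det2_neg_left (x y : Plane) : det2 (-x) y = -det2 x y := by
  simp only [det2, PiLp.neg_apply]; ring

theorem continuous_det2 : Continuous fun z : Plane × Plane => det2 z.1 z.2 := by
  unfold det2; fun_prop

theorem Continuous.det2 {X : Type*} [TopologicalSpace X] {f g : X → Plane} (hf : Continuous f)
    (hg : Continuous g) : Continuous fun x => det2 (f x) (g x) :=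
  continuous_det2.comp (hf.prodMk hg)

theorem Measurable.det2 {X : Type*} [MeasurableSpace X] {f g : X → Plane} (hf : Measurable f)
    (hg : Measurable g) : Measurable fun x => det2 (f x) (g x) :=
  continuous_det2.measurable.comp (hf.prodMk hg)

theorem exists_smul_of_det2_eq_zero {x y : Plane} (hx : x ≠ 0) (h : det2 x y = 0) :
    ∃ c : ℝ, y = c • x := by
  have hn := (inner_self_plane_pos hx).ne'
  simp only [det2] at h
  refine ⟨inner ℝ x y / inner ℝ x x, plane_ext ?_ ?_⟩
  · rw [PiLp.smul_apply, smul_eq_mul, div_mul_eq_mul_div, eq_div_iff hn, inner_plane, inner_plane]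
    linear_combination (-x 1) * h
  · rw [PiLp.smul_apply, smul_eq_mul, div_mul_eq_mul_div, eq_div_iff hn, inner_plane, inner_plane]
    linear_combination x 0 * h

theorem eq_or_eq_neg_of_det2_eq_zero {x y : Plane} (hx : ‖x‖ = 1) (hy : ‖y‖ = 1)
    (h : det2 x y = 0) : y = x ∨ y = -x := by
  obtain ⟨c, rfl⟩ := exists_smul_of_det2_eq_zero (norm_ne_zero_iff.1 (by rw [hx]; simp)) h
  rw [norm_smul, hx, mul_one, Real.norm_eq_abs] at hy
  rcases eq_or_eq_neg_of_abs_eq hy with rfl | rfl <;> simp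

/-- Cramer's rule without division: the coordinates of `d` with respect to `a`, `b`. -/
theorem det2_smul_eq (a b d : Plane) : det2 a b • d = det2 d b • a + det2 a d • b := by
  refine plane_ext ?_ ?_ <;> simp [det2] <;> ring

/-! ### Reflections and the measure on the circle of directions -/

/-- The reflection of the plane in the line orthogonal to `g`. -/
noncomputable def axisFlip (g : Plane) : Plane ≃ₗᵢ[ℝ] Plane := (Submodule.span ℝ {g})ᗮ.reflection

theorem axisFlip_apply (g v : Plane) :
    axisFlip g v = v - (2 * (inner ℝ g v / inner ℝ g g)) • g := by
  rw [axisFlip, Submodule.reflection_orthogonal_apply, Submodule.reflection_singleton_apply,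
    real_inner_self_eq_norm_sq, two_smul, two_mul, add_smul]
  simp

theorem axisFlip_axisFlip (g v : Plane) : axisFlip g (axisFlip g v) = v :=
  Submodule.reflection_reflection _ _

theorem det2_axisFlip (g v : Plane) : det2 g (axisFlip g v) = det2 g v := by
  simp [axisFlip_apply]

theorem measurable_axisFlip : Measurable fun z : Plane × Plane => axisFlip z.1 z.2 := by
  simp only [axisFlip_apply]; fun_prop

/-- The action of `axisFlip` on unit vectors. -/
noncomputable def unitFlip (g : Plane) (v : UnitVec) : UnitVec :=
  ⟨axisFlip g v, by
    rw [mem_sphere_zero_iff_norm, LinearIsometryEquiv.norm_map]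
    exact mem_sphere_zero_iff_norm.1 v.2⟩

@[simp] theorem coe_unitFlip (g : Plane) (v : UnitVec) : (unitFlip g v : Plane) = axisFlip g v :=
  rfl

theorem unitFlip_unitFlip (g : Plane) (v : UnitVec) : unitFlip g (unitFlip g v) = v :=
  Subtype.ext (axisFlip_axisFlip g v)

theorem Measurable.unitFlip {X : Type*} [MeasurableSpace X] {f : X → Plane} {g : X → UnitVec}
    (hf : Measurable f) (hg : Measurable g) : Measurable fun x => unitFlip (f x) (g x) :=
  (measurable_axisFlip.comp (hf.prodMk (measurable_subtype_coe.comp hg))).subtype_mk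

theorem continuous_unitVec : Continuous unitVec := by
  refine Continuous.subtype_mk ?_ _
  refine (PiLp.continuous_toLp 2 _).comp (continuous_pi fun i => ?_)
  fin_cases i
  · exact Real.continuous_cos
  · exact Real.continuous_sin

theorem periodic_unitVec : Function.Periodic unitVec (2 * Real.pi) := fun θ => by
  simp [unitVec]

instance : Fact (0 < 2 * Real.pi) := ⟨Real.two_pi_pos⟩

/-- Moves the measure to the group `AddCircle (2π)`, where invariance under `t ↦ a - t` is
available. -/
theorem circleMeasure_eq_map :
    circleMeasure = (volume : Measure (AddCircle (2 * Real.pi))).map periodic_unitVec.lift := by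
  have h := AddCircle.measurePreserving_mk (2 * Real.pi) 0
  have hc : Continuous periodic_unitVec.lift := continuous_coinduced_dom.2 continuous_unitVec
  rw [← h.map_eq, Measure.map_map hc.measurable h.measurable, zero_add]
  rfl

instance : IsFiniteMeasure circleMeasure := by
  unfold circleMeasure; infer_instance

theorem unitFlip_unitVec {g : Plane} (hg : g ≠ 0) :
    ∃ a : ℝ, ∀ θ, unitFlip g (unitVec θ) = unitVec (a - θ) := by
  -- If `g` has argument `φ`, its orthogonal line has angle `φ + π/2`, so the reflection sends `θ`
  -- to `2φ + π - θ`.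
  set z : ℂ := ⟨g 0, g 1⟩
  have hz : z ≠ 0 := fun h => hg (plane_eq_zero_iff.2 ⟨congrArg Complex.re h, congrArg Complex.im h⟩)
  have hn : ‖z‖ ≠ 0 := norm_ne_zero_iff.2 hz
  have h0 : g 0 = ‖z‖ * Real.cos z.arg := (Complex.norm_mul_cos_arg z).symm
  have h1 : g 1 = ‖z‖ * Real.sin z.arg := (Complex.norm_mul_sin_arg z).symm
  have hgg : inner ℝ g g = ‖z‖ ^ 2 := by
    rw [inner_plane, h0, h1]; linear_combination ‖z‖ ^ 2 * Real.sin_sq_add_cos_sq z.arg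
  have hs := Real.sin_sq_add_cos_sq z.arg
  refine ⟨2 * z.arg + Real.pi, fun θ => Subtype.ext ?_⟩
  rw [coe_unitFlip, axisFlip_apply, hgg, inner_plane, h0, h1]
  refine plane_ext ?_ ?_
  · simp only [unitVec, PiLp.sub_apply, PiLp.smul_apply, smul_eq_mul, Matrix.cons_val_zero,
      Matrix.cons_val_one, h0]
    rw [show 2 * z.arg + Real.pi - θ = 2 * z.arg - θ + Real.pi by ring, Real.cos_add_pi,
      Real.cos_sub, Real.cos_two_mul, Real.sin_two_mul]
    field_simp
    ring
  · simp only [unitVec, PiLp.sub_apply, PiLp.smul_apply, smul_eq_mul, Matrix.cons_val_zero,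
      Matrix.cons_val_one, h1]
    rw [show 2 * z.arg + Real.pi - θ = 2 * z.arg - θ + Real.pi by ring, Real.sin_add_pi,
      Real.sin_sub, Real.cos_two_mul, Real.sin_two_mul]
    field_simp
    linear_combination (-2 * Real.sin θ) * hs

theorem measurePreserving_unitFlip {g : Plane} (hg : g ≠ 0) :
    MeasurePreserving (unitFlip g) circleMeasure circleMeasure := by
  obtain ⟨a, ha⟩ := unitFlip_unitVec hg
  have hc : Continuous periodic_unitVec.lift := continuous_coinduced_dom.2 continuous_unitVec
  have hm : Measurable (unitFlip g) := measurable_const.unitFlip measurable_id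
  refine ⟨hm, ?_⟩
  have hs := Measure.measurePreserving_sub_left (volume : Measure (AddCircle (2 * Real.pi)))
    (a : AddCircle (2 * Real.pi))
  have hcomp : unitFlip g ∘ periodic_unitVec.lift
      = periodic_unitVec.lift ∘ fun t => (a : AddCircle (2 * Real.pi)) - t := by
    funext t
    induction t using QuotientAddGroup.induction_on with
    | H θ =>
      simp only [Function.comp]
      rw [← AddCircle.coe_sub]
      exact ha θ
  rw [circleMeasure_eq_map, Measure.map_map hm hc.measurable, hcomp,
    ← Measure.map_map hc.measurable hs.measurable, hs.map_eq]

/-! ### Supporting lines of convex sets -/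

/-- The interior is connected, and `det2 d (x - p)` vanishes only on the line, so it cannot change
sign there. -/
theorem pos_or_neg_of_line_disjoint_interior {S : Set Plane} (hS : Convex ℝ S) {p d : Plane}
    (hd : d ≠ 0) (h : ∀ t : ℝ, p + t • d ∉ interior S) :
    (∀ x ∈ interior S, 0 < det2 d (x - p)) ∨ ∀ x ∈ interior S, det2 d (x - p) < 0 := by
  by_contra! hcon
  obtain ⟨⟨x, hx, hx'⟩, y, hy, hy'⟩ := hcon
  have hc : Continuous fun x => det2 d (x - p) := continuous_const.det2 (by fun_prop)
  obtain ⟨z, hz, hz0⟩ := hS.interior.isPreconnected.intermediate_value hx hy hc.continuousOn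
    ⟨hx', hy'⟩
  obtain ⟨c, hc⟩ := exists_smul_of_det2_eq_zero hd hz0
  exact h c (by rwa [← hc, add_sub_cancel])

theorem nonneg_of_pos_interior {S : Set Plane} (hS : Convex ℝ S) (hi : (interior S).Nonempty)
    {p d : Plane} (h : ∀ x ∈ interior S, 0 < det2 d (x - p)) : ∀ x ∈ S, 0 ≤ det2 d (x - p) := by
  intro x hx
  have hc : Continuous fun x => det2 d (x - p) := continuous_const.det2 (by fun_prop)
  have hx' : x ∈ closure (interior S) := by
    rw [hS.closure_interior_eq_closure_of_nonempty_interior hi]; exact subset_closure hx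
  exact closure_minimal (fun y hy => (h y hy).le) (isClosed_Ici.preimage hc) hx'

/-- The rotation of the plane by a right angle. -/
noncomputable def rotate (d : Plane) : Plane := !₂[-d 1, d 0]

theorem det2_rotate (d : Plane) : det2 d (rotate d) = inner ℝ d d := by
  rw [inner_plane]; simp [det2, rotate]

theorem det2_pos_of_mem_interior {S : Set Plane} {p d : Plane} (hd : d ≠ 0)
    (h : ∀ x ∈ S, 0 ≤ det2 d (x - p)) {x : Plane} (hx : x ∈ interior S) :
    0 < det2 d (x - p) := by
  -- Moving `x` slightly towards the line keeps it in `S` and lowers the determinant by `t * ‖d‖²`,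
  -- so it was positive.
  have hc : Continuous fun t : ℝ => x - t • rotate d := by fun_prop
  have hev : ∀ᶠ t : ℝ in nhds 0, x - t • rotate d ∈ interior S :=
    hc.continuousAt.eventually_mem (by simpa using isOpen_interior.mem_nhds hx)
  obtain ⟨t, ht, ht0⟩ :=
    ((hev.filter_mono nhdsWithin_le_nhds).and (self_mem_nhdsWithin (s := Ioi (0 : ℝ)))).exists
  have h1 := h _ (interior_subset ht)
  rw [sub_right_comm, det2_sub_right, det2_smul_right, det2_rotate] at h1
  have h2 := mul_pos (mem_Ioi.1 ht0) (inner_self_plane_pos hd)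
  linarith

theorem exists_supporting_line {S : Set Plane} (hS : Convex ℝ S) (hi : (interior S).Nonempty)
    {p : Plane} (hp : p ∉ interior S) : ∃ d : Plane, d ≠ 0 ∧ ∀ x ∈ S, 0 ≤ det2 d (x - p) := by
  obtain ⟨f, hf⟩ := geometric_hahn_banach_open_point hS.interior isOpen_interior hp
  have hexp : ∀ y : Plane, f y = y 0 * f (EuclideanSpace.single 0 1)
      + y 1 * f (EuclideanSpace.single 1 1) := by
    intro y
    have : y = y 0 • EuclideanSpace.single (0 : Fin 2) (1 : ℝ)
        + y 1 • EuclideanSpace.single (1 : Fin 2) (1 : ℝ) := by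
      refine plane_ext ?_ ?_ <;> simp
    conv_lhs => rw [this]
    simp
  -- Chosen so that the separating functional is `-det2 d`.
  set d : Plane := !₂[-f (EuclideanSpace.single 1 1), f (EuclideanSpace.single 0 1)] with hd
  have hfd : ∀ y, det2 d y = -f y := by
    intro y; rw [hexp y]; simp [det2, hd]; ring
  have hpos : ∀ x ∈ interior S, 0 < det2 d (x - p) := by
    intro x hx
    rw [hfd, map_sub]
    linarith [hf x hx]
  refine ⟨d, ?_, nonneg_of_pos_interior hS hi hpos⟩
  rintro h0
  obtain ⟨x, hx⟩ := hi
  have := hpos x hx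
  rw [h0] at this
  simp [det2] at this

/-! ### Tangent and bisector lines at boundary points -/

/-- A compact convex plane set with non-empty interior, whose boundary is traced out by a regular
curve `γ` of period `L`, injectively on `[0, L)`. -/
structure IsBodyBoundedBy (S : Set Plane) (γ : ℝ → Plane) (L : ℝ) : Prop where
  isCompact : IsCompact S
  convex : Convex ℝ S
  nonempty_interior : (interior S).Nonempty
  differentiable : Differentiable ℝ γ
  injOn : InjOn γ (Ico 0 L)
  deriv_ne_zero : ∀ s, deriv γ s ≠ 0
  mem : ∀ s, γ s ∈ S
  image_eq : γ '' Ico 0 L = frontier S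

namespace IsBodyBoundedBy

variable {S : Set Plane} {γ : ℝ → Plane} {L : ℝ}

theorem exists_eq (hS : IsBodyBoundedBy S γ L) {p : Plane} (hp : p ∈ S) (hp' : p ∉ interior S) :
    ∃ s ∈ Ico 0 L, γ s = p := by
  have : p ∈ γ '' Ico 0 L := by
    rw [hS.image_eq, hS.isCompact.isClosed.frontier_eq]; exact ⟨hp, hp'⟩
  exact this

theorem mem_frontier (hS : IsBodyBoundedBy S γ L) {s : ℝ} (hs : s ∈ Ico 0 L) :
    γ s ∈ S ∧ γ s ∉ interior S := by
  have : γ s ∈ frontier S := hS.image_eq ▸ mem_image_of_mem γ hs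
  rwa [hS.isCompact.isClosed.frontier_eq] at this

end IsBodyBoundedBy

/-- Fermat's rule at a local minimum: a supporting line at a point of the curve is tangent to the
curve. -/
theorem det2_deriv_eq_zero {γ : ℝ → Plane} {s : ℝ} (hγ : DifferentiableAt ℝ γ s) {d : Plane}
    (h : ∀ᶠ u in nhds s, 0 ≤ det2 d (γ u - γ s)) : det2 d (deriv γ s) = 0 := by
  have hc (i : Fin 2) : HasDerivAt (fun u => γ u i) (deriv γ s i) s :=
    (EuclideanSpace.proj i : Plane →L[ℝ] ℝ).hasFDerivAt.comp_hasDerivAt s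
      hγ.hasDerivAt
  have hd : HasDerivAt (fun u => det2 d (γ u - γ s)) (det2 d (deriv γ s)) s := by
    unfold det2
    simp only [PiLp.sub_apply]
    exact (((hc 1).sub_const _).const_mul _).sub (((hc 0).sub_const _).const_mul _)
  refine IsLocalMin.hasDerivAt_eq_zero ?_ hd
  filter_upwards [h] with u hu
  simpa [det2] using hu

namespace IsBodyBoundedBy

variable {S : Set Plane} {γ : ℝ → Plane} {L : ℝ}

/-- No orientation of `γ` is assumed; the sign of `e` records on which side of the tangent line `S`
lies. -/
theorem exists_side (hS : IsBodyBoundedBy S γ L) {s : ℝ} (hs : γ s ∉ interior S) :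
    ∃ e : ℝ, e ≠ 0 ∧ (∀ x ∈ S, 0 ≤ e * det2 (deriv γ s) (x - γ s)) ∧
      ∀ x ∈ interior S, 0 < e * det2 (deriv γ s) (x - γ s) := by
  obtain ⟨d, hd, h⟩ := exists_supporting_line hS.convex hS.nonempty_interior hs
  have h0 : det2 d (deriv γ s) = 0 :=
    det2_deriv_eq_zero (hS.differentiable s) (.of_forall fun u => h _ (hS.mem u))
  obtain ⟨e, rfl⟩ := exists_smul_of_det2_eq_zero (x := deriv γ s) (hS.deriv_ne_zero s)
    (by rw [det2_swap, h0, neg_zero])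
  refine ⟨e, fun h => hd (by simp [h]), fun x hx => ?_, fun x hx => ?_⟩
  · rw [← det2_smul_left]; exact h x hx
  · rw [← det2_smul_left]; exact det2_pos_of_mem_interior hd h hx

theorem reflection_tangentLine (hS : IsBodyBoundedBy S γ L) {s : ℝ} (hs : γ s ∉ interior S)
    (v : Plane) : (tangentLine S (γ s)).reflection v = -axisFlip (deriv γ s) v := by
  obtain ⟨e, he, hle, hlt⟩ := hS.exists_side hs
  have hT : tangentLine S (γ s) = Submodule.span ℝ {deriv γ s} := by
    refine le_antisymm (fun y hy => ?_) ?_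
    · have hn : ∀ z : Plane, inner ℝ (-e • rotate (deriv γ s)) z = -(e * det2 (deriv γ s) z) := by
        intro z; rw [inner_plane]; simp [rotate, det2]; ring
      have hy0 := hy _ (Submodule.subset_span (show _ ∈ {n : Plane | ∀ x ∈ S,
        inner ℝ n (x - γ s) ≤ 0} from fun x hx => (hn _).trans_le (neg_nonpos.2 (hle x hx))))
      rw [hn, neg_eq_zero, mul_eq_zero, or_iff_right he] at hy0
      obtain ⟨c, rfl⟩ := exists_smul_of_det2_eq_zero (hS.deriv_ne_zero s) hy0
      exact Submodule.smul_mem _ _ (Submodule.mem_span_singleton_self _)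
    · rw [Submodule.span_singleton_le_iff_mem, tangentLine, Submodule.mem_orthogonal]
      intro n hn
      induction hn using Submodule.span_induction with
      | mem n hn =>
        have hr : ∀ z : Plane, det2 (rotate n) z = -inner ℝ n z := by
          intro z; rw [inner_plane]; simp [rotate, det2]; ring
        have := det2_deriv_eq_zero (hS.differentiable s) (d := rotate n) (.of_forall fun u => by
          rw [hr]; exact neg_nonneg.2 (hn _ (hS.mem u)))
        rwa [hr, neg_eq_zero] at this
      | zero => simp
      | add x y _ _ hx hy => rw [inner_add_left, hx, hy, add_zero]
      | smul c x _ hx => rw [inner_smul_left, hx, mul_zero]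
  rw [axisFlip, Submodule.reflection_orthogonal_apply, neg_neg]
  simp only [hT]

theorem isTangentDir_iff (hS : IsBodyBoundedBy S γ L) {s : ℝ} (hs : γ s ∉ interior S)
    {d : Plane} : IsTangentDir S (γ s) d ↔ ‖d‖ = 1 ∧ det2 (deriv γ s) d = 0 := by
  constructor
  · rintro ⟨hd, -, h⟩
    refine ⟨hd, ?_⟩
    have hd0 : d ≠ 0 := norm_ne_zero_iff.1 (by rw [hd]; simp)
    rw [det2_swap, neg_eq_zero]
    rcases pos_or_neg_of_line_disjoint_interior hS.convex hd0 h with h | h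
    · have h' := nonneg_of_pos_interior hS.convex hS.nonempty_interior h
      exact det2_deriv_eq_zero (hS.differentiable s) (.of_forall fun u => h' _ (hS.mem u))
    · have h' := nonneg_of_pos_interior hS.convex hS.nonempty_interior (d := -d) (p := γ s)
        fun x hx => by simpa using h x hx
      have := det2_deriv_eq_zero (hS.differentiable s) (.of_forall fun u => h' _ (hS.mem u))
      simpa using this
  · rintro ⟨hd, h⟩
    refine ⟨hd, ⟨0, le_rfl, by simpa using hS.mem s⟩, fun t ht => ?_⟩
    obtain ⟨e, he, -, hlt⟩ := hS.exists_side hs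
    have := hlt _ ht
    simp [h] at this

theorem bisectorLine_eq (hS : IsBodyBoundedBy S γ L) {s : ℝ} (hs : γ s ∉ interior S) :
    bisectorLine S (γ s) = (Submodule.span ℝ {deriv γ s})ᗮ := by
  have hg := hS.deriv_ne_zero s
  have hn := norm_ne_zero_iff.2 hg
  ext x
  rw [Submodule.mem_orthogonal_singleton_iff_inner_right]
  constructor
  · intro hx
    have h1 : ‖(‖deriv γ s‖⁻¹ • deriv γ s)‖ = 1 := by
      rw [norm_smul, norm_inv, norm_norm, inv_mul_cancel₀ hn]
    have := hx (‖deriv γ s‖⁻¹ • deriv γ s) (-(‖deriv γ s‖⁻¹ • deriv γ s))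
      ((hS.isTangentDir_iff hs).2 ⟨h1, by simp⟩)
      ((hS.isTangentDir_iff hs).2 ⟨by rw [norm_neg, h1], by simp⟩)
    rw [inner_neg_left, inner_smul_left, self_eq_neg] at this
    simpa [hn, hg] using this
  · intro hx h k hh hk
    obtain ⟨a, rfl⟩ := exists_smul_of_det2_eq_zero hg ((hS.isTangentDir_iff hs).1 hh).2
    obtain ⟨b, rfl⟩ := exists_smul_of_det2_eq_zero hg ((hS.isTangentDir_iff hs).1 hk).2
    simp [inner_smul_left, hx]

end IsBodyBoundedBy

/-! ### Tangent rays from exterior points -/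

/-- `h` and `k` are the unit directions of the right and the left ray from `p` tangent to `S`. -/
structure IsTangentPair (S : Set Plane) (p h k : Plane) : Prop where
  norm_left : ‖h‖ = 1
  norm_right : ‖k‖ = 1
  det_pos : 0 < det2 h k
  meets_left : ∃ t : ℝ, 0 < t ∧ p + t • h ∈ S
  meets_right : ∃ t : ℝ, 0 < t ∧ p + t • k ∈ S
  nonneg_left : ∀ x ∈ S, 0 ≤ det2 h (x - p)
  nonneg_right : ∀ x ∈ S, 0 ≤ det2 (x - p) k

/-- A functional `f` positive on `S - p` makes the slope `det2 e (x - p) / f (x - p)` continuous on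
`S`. By compactness it has a minimum and a maximum, attained at the contact points of the two
tangent rays. -/
theorem exists_isTangentPair {S : Set Plane} (hcS : IsCompact S) (hS : Convex ℝ S)
    (hi : (interior S).Nonempty) {p : Plane} (hp : p ∉ S) : ∃ h k, IsTangentPair S p h k := by
  obtain ⟨f, hf⟩ : ∃ f : Plane →L[ℝ] ℝ, ∀ x ∈ S, 0 < f (x - p) := by
    obtain ⟨f, u, v, h1, h2, h3⟩ := geometric_hahn_banach_compact_closed hS hcS
      (convex_singleton p) isClosed_singleton (Set.disjoint_singleton_right.2 hp)
    refine ⟨-f, fun x hx => ?_⟩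
    have := h1 x hx
    have := h3 p rfl
    simp only [neg_apply, map_sub]
    linarith
  have hexp : ∀ y : Plane, f y = y 0 * f (EuclideanSpace.single 0 1)
      + y 1 * f (EuclideanSpace.single 1 1) := by
    intro y
    have : y = y 0 • EuclideanSpace.single (0 : Fin 2) (1 : ℝ)
        + y 1 • EuclideanSpace.single (1 : Fin 2) (1 : ℝ) := by
      refine plane_ext ?_ ?_ <;> simp
    conv_lhs => rw [this]
    simp
  set e : Plane := !₂[f (EuclideanSpace.single 0 1), f (EuclideanSpace.single 1 1)] with he
  have hfe : ∀ y, f y = inner ℝ e y := by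
    intro y; rw [hexp y, inner_plane]; simp [he]; ring
  have hSne : S.Nonempty := hi.mono interior_subset
  have he0 : e ≠ 0 := by
    rintro h0
    obtain ⟨x, hx⟩ := hSne
    have := hf x hx
    rw [hfe, h0, inner_zero_left] at this
    exact this.false
  have hee := inner_self_plane_pos he0
  have hcont : ContinuousOn (fun x => det2 e (x - p) / f (x - p)) S :=
    (continuous_const.det2 (by fun_prop)).continuousOn.div (by fun_prop)
      fun x hx => (hf x hx).ne'
  have hid : ∀ y z : Plane, inner ℝ e e * det2 y z = f y * det2 e z - det2 e y * f z := by
    intro y z; rw [hfe, hfe, inner_plane, inner_plane, inner_plane]; simp only [det2]; ring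
  obtain ⟨a, ha, hamin⟩ := hcS.exists_isMinOn hSne hcont
  obtain ⟨b, hb, hbmax⟩ := hcS.exists_isMaxOn hSne hcont
  have hmono : ∀ x ∈ S, ∀ y ∈ S, det2 e (x - p) / f (x - p) ≤ det2 e (y - p) / f (y - p) →
      0 ≤ det2 (x - p) (y - p) := by
    intro x hx y hy h
    rw [div_le_div_iff₀ (hf x hx) (hf y hy)] at h
    refine nonneg_of_mul_nonneg_right (a := inner ℝ e e) ?_ hee
    rw [hid]; linarith
  have hna : a - p ≠ 0 := sub_ne_zero.2 fun h => hp (h ▸ ha)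
  have hnb : b - p ≠ 0 := sub_ne_zero.2 fun h => hp (h ▸ hb)
  have hA : ∀ x ∈ S, 0 ≤ det2 (a - p) (x - p) := fun x hx => hmono a ha x hx (hamin hx)
  have hB : ∀ x ∈ S, 0 ≤ det2 (x - p) (b - p) := fun x hx => hmono x hx b hb (hbmax hx)
  -- If the extreme directions were parallel, positivity of `f` would make them equal as rays,
  -- leaving no room for an interior point.
  have hAB : 0 < det2 (a - p) (b - p) := by
    refine lt_of_le_of_ne (hA b hb) fun h0 => ?_
    obtain ⟨c, hc⟩ := hi
    have h1 := det2_pos_of_mem_interior hna hA hc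
    obtain ⟨l, hl⟩ := exists_smul_of_det2_eq_zero hna h0.symm
    have hl0 : 0 < l := by
      have h2 := hf b hb
      rw [hl, map_smul, smul_eq_mul] at h2
      exact pos_of_mul_pos_left h2 (hf a ha).le
    have h3 := hB c (interior_subset hc)
    rw [hl, det2_smul_right, det2_swap (a - p)] at h3
    nlinarith
  have hpa := norm_pos_iff.2 hna
  have hpb := norm_pos_iff.2 hnb
  refine ⟨‖a - p‖⁻¹ • (a - p), ‖b - p‖⁻¹ • (b - p), ?_, ?_, ?_, ⟨‖a - p‖, hpa, ?_⟩,
    ⟨‖b - p‖, hpb, ?_⟩, fun x hx => ?_, fun x hx => ?_⟩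
  · rw [norm_smul, norm_inv, norm_norm, inv_mul_cancel₀ hpa.ne']
  · rw [norm_smul, norm_inv, norm_norm, inv_mul_cancel₀ hpb.ne']
  · rw [det2_smul_left, det2_smul_right]; positivity
  · rwa [smul_inv_smul₀ hpa.ne', add_sub_cancel]
  · rwa [smul_inv_smul₀ hpb.ne', add_sub_cancel]
  · rw [det2_smul_left]; exact mul_nonneg (by positivity) (hA x hx)
  · rw [det2_smul_right]; exact mul_nonneg (by positivity) (hB x hx)

namespace IsTangentPair

variable {S : Set Plane} {p h k : Plane}

/-- The visible directions form the cone spanned by `h` and `k`: every ray in it crosses the segment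
joining two points of `S` on the tangent rays, and that segment lies in `S`. -/
theorem meets_iff (T : IsTangentPair S p h k) (hS : Convex ℝ S) (hp : p ∉ S) {d : Plane}
    (hd : d ≠ 0) :
    (∃ t : ℝ, 0 ≤ t ∧ p + t • d ∈ S) ↔ 0 ≤ det2 h d ∧ 0 ≤ det2 d k := by
  constructor
  · rintro ⟨t, ht, hm⟩
    have ht' : 0 < t := ht.lt_of_ne fun h0 => hp (by simpa [← h0] using hm)
    have h1 := T.nonneg_left _ hm
    have h2 := T.nonneg_right _ hm
    rw [add_sub_cancel_left] at h1 h2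
    rw [det2_smul_right] at h1
    rw [det2_smul_left] at h2
    exact ⟨nonneg_of_mul_nonneg_right h1 ht', nonneg_of_mul_nonneg_right h2 ht'⟩
  · rintro ⟨h1, h2⟩
    obtain ⟨t, ht, hth⟩ := T.meets_left
    obtain ⟨u, hu, huk⟩ := T.meets_right
    have hD := T.det_pos
    have hexp := det2_smul_eq h k d
    -- The Cramer coordinates of `d`, rescaled by the contact times and divided by their sum `m`,
    -- are the weights of the crossing point on the segment.
    set m := det2 d k / t + det2 h d / u with hm
    have hm0 : 0 < m := by
      refine lt_of_le_of_ne (by positivity) fun h0 => hd ?_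
      have e1 : det2 d k / t = 0 := by
        have : 0 ≤ det2 d k / t := by positivity
        have : 0 ≤ det2 h d / u := by positivity
        linarith
      have e2 : det2 h d / u = 0 := by linarith
      have e1' : det2 d k = 0 := by simpa [ht.ne'] using e1
      have e2' : det2 h d = 0 := by simpa [hu.ne'] using e2
      rw [e1', e2', zero_smul, zero_smul, add_zero] at hexp
      exact (smul_eq_zero.1 hexp).resolve_left hD.ne'
    refine ⟨det2 h k / m, by positivity, ?_⟩
    have hcomb := hS hth huk (a := det2 d k / t / m) (b := det2 h d / u / m) (by positivity)
      (by positivity) (by rw [← add_div, ← hm, div_self hm0.ne'])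
    convert hcomb using 1
    have hp1 : (det2 d k / t / m + det2 h d / u / m) • p = p := by
      rw [← add_div, ← hm, div_self hm0.ne', one_smul]
    have hdd : (det2 h k / m) • d = (det2 d k / t / m * t) • h + (det2 h d / u / m * u) • k := by
      rw [div_eq_inv_mul, mul_smul, hexp, smul_add, smul_smul, smul_smul]
      congr 2 <;> field_simp
    rw [hdd]
    conv_lhs => rw [← hp1]
    module

theorem isTangentDir_iff (T : IsTangentPair S p h k) (hS : Convex ℝ S)
    (hi : (interior S).Nonempty) (hp : p ∉ S) {d : Plane} :
    IsTangentDir S p d ↔ d = h ∨ d = k := by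
  have hh0 : h ≠ 0 := norm_ne_zero_iff.1 (by rw [T.norm_left]; simp)
  have hk0 : k ≠ 0 := norm_ne_zero_iff.1 (by rw [T.norm_right]; simp)
  constructor
  · rintro ⟨hd, hm, hline⟩
    have hd0 : d ≠ 0 := norm_ne_zero_iff.1 (by rw [hd]; simp)
    obtain ⟨h1, h2⟩ := (T.meets_iff hS hp hd0).1 hm
    have hz : det2 h d = 0 ∨ det2 d k = 0 := by
      obtain ⟨t, ht, hth⟩ := T.meets_left
      obtain ⟨u, hu, huk⟩ := T.meets_right
      -- The body lies on one side of the line. Testing this on the contact point of `h` (or of `k`)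
      -- gives the inequality opposite to the cone condition.
      rcases pos_or_neg_of_line_disjoint_interior hS hd0 hline with h | h
      · have h3 := nonneg_of_pos_interior hS hi h _ hth
        rw [add_sub_cancel_left, det2_smul_right, det2_swap] at h3
        exact .inl (by nlinarith)
      · have h3 := nonneg_of_pos_interior hS hi (d := -d) (p := p)
          (fun x hx => by rw [det2_neg_left]; exact neg_pos.2 (h x hx)) _ huk
        rw [add_sub_cancel_left, det2_smul_right, det2_neg_left] at h3
        exact .inr (by nlinarith)
    have hD := T.det_pos
    rcases hz with hz | hz
    · rcases eq_or_eq_neg_of_det2_eq_zero T.norm_left hd hz with rfl | rfl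
      · exact .inl rfl
      · rw [det2_neg_left] at h2; linarith
    · rw [det2_swap, neg_eq_zero] at hz
      rcases eq_or_eq_neg_of_det2_eq_zero T.norm_right hd hz with rfl | rfl
      · exact .inr rfl
      · rw [det2_neg_right] at h1; linarith
  · rintro (rfl | rfl)
    · refine ⟨T.norm_left, T.meets_left.imp fun t ht => ⟨ht.1.le, ht.2⟩, fun t ht => ?_⟩
      have := det2_pos_of_mem_interior hh0 T.nonneg_left ht
      simp at this
    · refine ⟨T.norm_right, T.meets_right.imp fun t ht => ⟨ht.1.le, ht.2⟩, fun t ht => ?_⟩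
      have := det2_pos_of_mem_interior (d := -d) (p := p) (neg_ne_zero.2 hk0)
        (fun x hx => by simpa [det2_swap d] using T.nonneg_right x hx) ht
      simp at this

theorem ne (T : IsTangentPair S p h k) : h - k ≠ 0 := by
  rw [sub_ne_zero]
  rintro rfl
  have := T.det_pos
  simp at this

theorem bisectorLine_eq (T : IsTangentPair S p h k) (hS : Convex ℝ S)
    (hi : (interior S).Nonempty) (hp : p ∉ S) :
    bisectorLine S p = (Submodule.span ℝ {h - k})ᗮ := by
  ext x
  rw [Submodule.mem_orthogonal_singleton_iff_inner_right, inner_sub_left, sub_eq_zero]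
  constructor
  · intro hx
    exact hx h k ((T.isTangentDir_iff hS hi hp).2 (.inl rfl))
      ((T.isTangentDir_iff hS hi hp).2 (.inr rfl))
  · intro hx a b ha hb
    rcases (T.isTangentDir_iff hS hi hp).1 ha with rfl | rfl <;>
    rcases (T.isTangentDir_iff hS hi hp).1 hb with rfl | rfl <;> simp [hx]

theorem axisFlip_left (T : IsTangentPair S p h k) : axisFlip (h - k) h = k :=
  Submodule.reflection_sub (by rw [T.norm_left, T.norm_right])

theorem axisFlip_right (T : IsTangentPair S p h k) : axisFlip (h - k) k = h := by
  have := axisFlip_axisFlip (h - k) h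
  rwa [T.axisFlip_left] at this

/-- Exchanging `h` and `k` exchanges the two nonnegative Cramer coordinates of `d`, so the cone is
preserved. -/
theorem meets_axisFlip (T : IsTangentPair S p h k) (hS : Convex ℝ S) (hp : p ∉ S) {d : Plane}
    (hd : d ≠ 0) (hm : ∃ t : ℝ, 0 ≤ t ∧ p + t • d ∈ S) :
    ∃ t : ℝ, 0 ≤ t ∧ p + t • axisFlip (h - k) d ∈ S := by
  have hD := T.det_pos
  obtain ⟨h1, h2⟩ := (T.meets_iff hS hp hd).1 hm
  have hexp := congrArg (axisFlip (h - k)) (det2_smul_eq h k d)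
  rw [map_add, map_smul, map_smul, map_smul, T.axisFlip_left, T.axisFlip_right] at hexp
  refine (T.meets_iff hS hp (by simpa using hd)).2 ⟨?_, ?_⟩
  · have := congrArg (det2 h) hexp
    simp only [det2_smul_right, det2_add_right, det2_self, mul_zero, add_zero] at this
    nlinarith
  · have := congrArg (fun z => det2 z k) hexp
    simp only [det2_smul_left, det2_add_left, det2_self, mul_zero, zero_add] at this
    nlinarith

end IsTangentPair

/-! ### The first hitting time and its measurability -/

section HitTime

variable {S : Set Plane} {p v : Plane}

/-- The time at which the ray from `p` with velocity `v` first meets `S`. -/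
noncomputable def hitTime (S : Set Plane) (p v : Plane) : ℝ :=
  sInf {t : ℝ | 0 ≤ t ∧ p + t • v ∈ S}

theorem bouncePoint_eq (S : Set Plane) (p v : Plane) :
    bouncePoint S p v = p + hitTime S p v • v := rfl

theorem hitTime_nonneg (S : Set Plane) (p v : Plane) : 0 ≤ hitTime S p v :=
  Real.sInf_nonneg fun _ ht => ht.1

theorem hitTime_le {t : ℝ} (ht : 0 ≤ t) (h : p + t • v ∈ S) : hitTime S p v ≤ t :=
  csInf_le ⟨0, fun _ ht => ht.1⟩ ⟨ht, h⟩

theorem bouncePoint_mem (hS : IsClosed S) (h : ∃ t : ℝ, 0 ≤ t ∧ p + t • v ∈ S) :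
    bouncePoint S p v ∈ S := by
  have hc : IsClosed {t : ℝ | 0 ≤ t ∧ p + t • v ∈ S} :=
    isClosed_Ici.inter (hS.preimage (f := fun t : ℝ => p + t • v) (by fun_prop))
  exact (hc.csInf_mem h ⟨0, fun _ ht => ht.1⟩).2

theorem bouncePoint_notMem_interior (hp : p ∉ interior S) : bouncePoint S p v ∉ interior S := by
  intro hw
  rw [bouncePoint_eq] at hw
  have hpos : 0 < hitTime S p v :=
    (hitTime_nonneg S p v).lt_of_ne fun h0 => hp (by simpa [← h0] using hw)
  have hc : Continuous fun t : ℝ => p + t • v := by fun_prop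
  have hev : ∀ᶠ t : ℝ in nhds (hitTime S p v), p + t • v ∈ interior S ∧ 0 < t :=
    (hc.continuousAt.eventually_mem (isOpen_interior.mem_nhds hw)).and (lt_mem_nhds hpos)
  obtain ⟨t, ht, htlt⟩ := ((hev.filter_mono nhdsWithin_le_nhds).and
    (self_mem_nhdsWithin (s := Iio (hitTime S p v)))).exists
  exact absurd (hitTime_le ht.2.le (interior_subset ht.1)) (not_le.2 htlt)

theorem dist_bouncePoint (hv : ‖v‖ = 1) : dist p (bouncePoint S p v) = hitTime S p v := by
  rw [bouncePoint_eq, dist_self_add_right, norm_smul, hv, mul_one,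
    Real.norm_of_nonneg (hitTime_nonneg S p v)]

theorem isClosed_meets_within {E : Type*} [TopologicalSpace E] {f g : E → Plane}
    (hf : Continuous f) (hg : Continuous g) (hS : IsClosed S) (a : ℝ) :
    IsClosed {z : E | ∃ t : ℝ, (0 ≤ t ∧ t ≤ a) ∧ f z + t • g z ∈ S} := by
  have hc : IsClosed {q : E × Icc 0 a | f q.1 + (q.2 : ℝ) • g q.1 ∈ S} :=
    hS.preimage (by fun_prop)
  convert isClosedMap_fst_of_compactSpace _ hc using 1
  ext z
  simp

/-- Bounding the time gives a closed set, as the projection of a closed set along a compact factor;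
let the bound run through the naturals. -/
theorem measurableSet_meets {E : Type*} [TopologicalSpace E] [MeasurableSpace E]
    [OpensMeasurableSpace E] {f g : E → Plane} (hf : Continuous f) (hg : Continuous g)
    (hS : IsClosed S) : MeasurableSet {z : E | ∃ t : ℝ, 0 ≤ t ∧ f z + t • g z ∈ S} := by
  have : {z : E | ∃ t : ℝ, 0 ≤ t ∧ f z + t • g z ∈ S}
      = ⋃ n : ℕ, {z : E | ∃ t : ℝ, (0 ≤ t ∧ t ≤ n) ∧ f z + t • g z ∈ S} := by
    ext z
    simp only [mem_ofPred_eq, mem_iUnion]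
    refine ⟨fun ⟨t, ht, h⟩ => ?_, fun ⟨n, t, ht, h⟩ => ⟨t, ht.1, h⟩⟩
    obtain ⟨n, hn⟩ := exists_nat_ge t
    exact ⟨n, t, ⟨ht, hn⟩, h⟩
  rw [this]
  exact .iUnion fun n => (isClosed_meets_within hf hg hS n).measurableSet

theorem measurable_hitTime (hS : IsClosed S) :
    Measurable fun z : Plane × UnitVec => hitTime S z.1 z.2 := by
  have hm := measurableSet_meets (E := Plane × UnitVec) (f := fun z => z.1)
    (g := fun z => (z.2 : Plane)) (by fun_prop) (by fun_prop) hS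
  refine measurable_of_restrict_of_restrict_compl hm ?_ ?_
  · refine measurable_of_Iic fun a => ?_
    convert measurable_subtype_coe (isClosed_meets_within (E := Plane × UnitVec)
      (f := fun z => z.1) (g := fun z => (z.2 : Plane)) (by fun_prop) (by fun_prop)
      hS a).measurableSet using 1
    ext ⟨z, hz⟩
    simp only [mem_preimage, domRestrict_apply, mem_Iic, mem_ofPred_eq]
    exact ⟨fun h => ⟨_, ⟨hitTime_nonneg _ _ _, h⟩, bouncePoint_mem hS hz⟩,
      fun ⟨t, ht, h⟩ => (hitTime_le ht.1 h).trans ht.2⟩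
  -- A ray that misses `S` has hitting time `sInf ∅ = 0`.
  · convert measurable_const (a := (0 : ℝ)) using 1
    ext ⟨z, hz⟩
    simp only [mem_compl_iff, mem_ofPred_eq] at hz
    simp only [domRestrict_apply, hitTime]
    convert Real.sInf_empty
    exact eq_empty_of_forall_notMem fun t ht => hz ⟨t, ht⟩

theorem measurableSet_visibilityDomain (hS : IsClosed S) :
    MeasurableSet (visibilityDomain S) := by
  have hm := measurableSet_meets (E := Plane × UnitVec) (f := fun z => z.1)
    (g := fun z => (z.2 : Plane)) (by fun_prop) (by fun_prop) hS
  exact (isOpen_interior.isClosed_compl.measurableSet.preimage measurable_fst).inter hm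

end HitTime

/-! ### The two factors of the map: measurability and invariance of the domain -/

/-- A function with measurable graph over `A` is measurable on `A`. -/
theorem measurable_restrict_of_measurableSet_graph {α β : Type*} [MeasurableSpace α]
    [StandardBorelSpace α] [MeasurableSpace β] [StandardBorelSpace β] {A : Set α} {f : α → β}
    (h : MeasurableSet {z : α × β | z.1 ∈ A ∧ f z.1 = z.2}) : Measurable (A.domRestrict f) := by
  intro B hB
  -- Lusin–Souslin: the projection is injective on a graph, so it maps Borel subsets of it to Borel
  -- sets.
  have hi : MeasurableSet (Prod.fst '' ({z : α × β | z.1 ∈ A ∧ f z.1 = z.2} ∩ Prod.snd ⁻¹' B)) := by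
    refine (h.inter (measurable_snd hB)).image_of_measurable_injOn measurable_fst ?_
    rintro ⟨a, b⟩ ⟨⟨-, h1⟩, -⟩ ⟨a', b'⟩ ⟨⟨-, h2⟩, -⟩ (rfl : a = a')
    exact Prod.ext rfl (h1.symm.trans h2)
  convert measurable_subtype_coe hi using 1
  ext ⟨a, ha⟩
  constructor
  · intro hb
    exact ⟨(a, f a), ⟨⟨ha, rfl⟩, hb⟩, rfl⟩
  · rintro ⟨⟨a', b⟩, ⟨⟨-, h1⟩, hb⟩, (rfl : a' = a)⟩
    change f a' = b at h1
    change f a' ∈ B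
    rwa [h1]

open Classical in
/-- The parameter in `[0, L)` of a point of a curve. -/
noncomputable def curveParam (γ : ℝ → Plane) (L : ℝ) (w : Plane) : ℝ :=
  if h : ∃ s ∈ Ico 0 L, γ s = w then h.choose else 0

open Classical in
/-- The two directions of the rays from `p` tangent to `S`. -/
noncomputable def tangentPair (S : Set Plane) (p : Plane) : Plane × Plane :=
  if h : p ∉ S ∧ ∃ q : Plane × Plane, IsTangentPair S p q.1 q.2 then h.2.choose else 0

open Classical in
/-- A vector orthogonal to the bisector of the angle formed by the rays from `p` tangent to `S`. -/
noncomputable def bisectorAxis (S : Set Plane) (γ : ℝ → Plane) (L : ℝ) (p : Plane) : Plane :=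
  if p ∈ S then deriv γ (curveParam γ L p) else (tangentPair S p).1 - (tangentPair S p).2

/-- The first half of the bouncing outer billiard map: `(p, v)` is mapped to the point `p'` and the
direction from `p'` back to the bounce point. -/
noncomputable def bounceMap (S : Set Plane) (γ : ℝ → Plane) (L : ℝ) (z : Plane × UnitVec) :
    Plane × UnitVec :=
  (bouncePoint S z.1 z.2
      - hitTime S z.1 z.2 • axisFlip (deriv γ (curveParam γ L (bouncePoint S z.1 z.2))) z.2,
    unitFlip (deriv γ (curveParam γ L (bouncePoint S z.1 z.2))) z.2)

/-- The second half of the bouncing outer billiard map: reflection across the bisector. -/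
noncomputable def bisectorMap (S : Set Plane) (γ : ℝ → Plane) (L : ℝ) (z : Plane × UnitVec) :
    Plane × UnitVec :=
  (z.1, unitFlip (bisectorAxis S γ L z.1) z.2)

/-- The sign of the determinant fixes the order of the pair. The choice in `tangentPair` is thus
determined by measurable conditions, which makes its graph measurable. -/
theorem IsTangentPair.unique {S : Set Plane} {p h k h' k' : Plane} (hS : Convex ℝ S)
    (hi : (interior S).Nonempty) (hp : p ∉ S) (T : IsTangentPair S p h k)
    (hh : IsTangentDir S p h') (hk : IsTangentDir S p k') (hd : 0 < det2 h' k') :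
    h' = h ∧ k' = k := by
  have hD := T.det_pos
  rw [T.isTangentDir_iff hS hi hp] at hh hk
  rcases hh with rfl | rfl <;> rcases hk with rfl | rfl
  · simp at hd
  · exact ⟨rfl, rfl⟩
  · rw [det2_swap] at hd; linarith
  · simp at hd

theorem measurableSet_isTangentDir {S : Set Plane} (hS : IsClosed S) :
    MeasurableSet {z : Plane × Plane | IsTangentDir S z.1 z.2} := by
  have h3 : IsClosed {z : Plane × Plane | ∀ t : ℝ, z.1 + t • z.2 ∉ interior S} := by
    simp only [ofPred_forall]
    exact isClosed_iInter fun t => isOpen_interior.isClosed_compl.preimage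
      (f := fun z : Plane × Plane => z.1 + t • z.2) (by fun_prop)
  have h1 : MeasurableSet {z : Plane × Plane | ‖z.2‖ = 1} :=
    measurableSet_eq_fun (by fun_prop) measurable_const
  exact h1.inter ((measurableSet_meets continuous_fst continuous_snd hS).inter h3.measurableSet)

namespace IsBodyBoundedBy

variable {S : Set Plane} {γ : ℝ → Plane} {L : ℝ}

theorem curveParam_spec (hS : IsBodyBoundedBy S γ L) {p : Plane} (hp : p ∈ S)
    (hp' : p ∉ interior S) : curveParam γ L p ∈ Ico 0 L ∧ γ (curveParam γ L p) = p := by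
  have h := hS.exists_eq hp hp'
  rw [curveParam, dif_pos h]
  exact h.choose_spec

theorem curveParam_apply (hS : IsBodyBoundedBy S γ L) {s : ℝ} (hs : s ∈ Ico 0 L) :
    curveParam γ L (γ s) = s := by
  obtain ⟨h1, h2⟩ := hS.curveParam_spec (hS.mem s) (hS.mem_frontier hs).2
  exact hS.injOn h1 hs h2

theorem tangentPair_spec (hS : IsBodyBoundedBy S γ L) {p : Plane} (hp : p ∉ S) :
    IsTangentPair S p (tangentPair S p).1 (tangentPair S p).2 := by
  have h : ∃ q : Plane × Plane, IsTangentPair S p q.1 q.2 := by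
    obtain ⟨h, k, T⟩ := exists_isTangentPair hS.isCompact hS.convex hS.nonempty_interior hp
    exact ⟨(h, k), T⟩
  rw [tangentPair, dif_pos ⟨hp, h⟩]
  exact h.choose_spec

theorem measurable_curveParam (hS : IsBodyBoundedBy S γ L) : Measurable (curveParam γ L) := by
  have hc := hS.differentiable.continuous
  refine measurable_of_restrict_of_restrict_compl (s := frontier S)
    isClosed_frontier.measurableSet ?_ ?_
  · apply measurable_restrict_of_measurableSet_graph
    have : {z : Plane × ℝ | z.1 ∈ frontier S ∧ curveParam γ L z.1 = z.2}
        = {z : Plane × ℝ | z.2 ∈ Ico 0 L} ∩ {z : Plane × ℝ | γ z.2 = z.1} := by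
      ext ⟨w, s⟩
      simp only [mem_ofPred_eq, mem_inter_iff]
      constructor
      · rintro ⟨hw, rfl⟩
        rw [hS.isCompact.isClosed.frontier_eq] at hw
        exact hS.curveParam_spec hw.1 hw.2
      · rintro ⟨hs, rfl⟩
        exact ⟨hS.image_eq ▸ mem_image_of_mem γ hs, hS.curveParam_apply hs⟩
    rw [this]
    exact (measurableSet_Ico.preimage measurable_snd).inter
      (measurableSet_eq_fun (hc.measurable.comp measurable_snd) measurable_fst)
  · convert measurable_const (a := (0 : ℝ)) using 1
    ext ⟨w, hw⟩
    rw [domRestrict_apply, curveParam, dif_neg]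
    rintro ⟨s, hs, rfl⟩
    exact hw (hS.image_eq ▸ mem_image_of_mem γ hs)

theorem measurable_tangentPair (hS : IsBodyBoundedBy S γ L) : Measurable (tangentPair S) := by
  have hcl := hS.isCompact.isClosed
  refine measurable_of_restrict_of_restrict_compl (s := Sᶜ) hcl.measurableSet.compl ?_ ?_
  · apply measurable_restrict_of_measurableSet_graph
    have : {z : Plane × Plane × Plane | z.1 ∈ Sᶜ ∧ tangentPair S z.1 = z.2}
        = {z | z.1 ∈ Sᶜ} ∩ ({z | IsTangentDir S z.1 z.2.1} ∩ ({z | IsTangentDir S z.1 z.2.2} ∩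
          {z | 0 < det2 z.2.1 z.2.2})) := by
      ext ⟨p, h, k⟩
      simp only [mem_ofPred_eq, mem_inter_iff, and_congr_right_iff]
      intro hp
      have T := hS.tangentPair_spec hp
      constructor
      · intro he
        rw [he] at T
        exact ⟨(T.isTangentDir_iff hS.convex hS.nonempty_interior hp).2 (.inl rfl),
          (T.isTangentDir_iff hS.convex hS.nonempty_interior hp).2 (.inr rfl), T.det_pos⟩
      · rintro ⟨h1, h2, h3⟩
        obtain ⟨e1, e2⟩ := T.unique hS.convex hS.nonempty_interior hp h1 h2 h3
        exact Prod.ext e1.symm e2.symm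
    rw [this]
    have hT := measurableSet_isTangentDir hcl
    refine (hcl.measurableSet.compl.preimage measurable_fst).inter
      ((hT.preimage (f := fun z : Plane × Plane × Plane => (z.1, z.2.1)) (by fun_prop)).inter
      ((hT.preimage (f := fun z : Plane × Plane × Plane => (z.1, z.2.2)) (by fun_prop)).inter ?_))
    exact measurableSet_lt measurable_const
      (Measurable.det2 (by fun_prop) (by fun_prop))
  · convert measurable_const (a := (0 : Plane × Plane)) using 1
    ext1 ⟨p, hp⟩
    rw [domRestrict_apply, tangentPair, dif_neg]
    exact fun h => hp h.1

theorem measurable_bisectorAxis (hS : IsBodyBoundedBy S γ L) :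
    Measurable (bisectorAxis S γ L) := by
  unfold bisectorAxis
  have h := hS.measurable_tangentPair
  exact Measurable.ite hS.isCompact.isClosed.measurableSet
    ((measurable_deriv γ).comp hS.measurable_curveParam) (h.fst.sub h.snd)

theorem measurable_bisectorMap (hS : IsBodyBoundedBy S γ L) :
    Measurable (bisectorMap S γ L) :=
  measurable_fst.prodMk ((hS.measurable_bisectorAxis.comp measurable_fst).unitFlip measurable_snd)

theorem measurable_bounceMap (hS : IsBodyBoundedBy S γ L) : Measurable (bounceMap S γ L) := by
  have hv : Measurable fun z : Plane × UnitVec => (z.2 : Plane) :=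
    measurable_subtype_coe.comp measurable_snd
  have ht := measurable_hitTime (S := S) hS.isCompact.isClosed
  have hw : Measurable fun z : Plane × UnitVec => bouncePoint S z.1 z.2 :=
    measurable_fst.add (ht.smul hv)
  have hg : Measurable fun z : Plane × UnitVec =>
      deriv γ (curveParam γ L (bouncePoint S z.1 z.2)) :=
    (measurable_deriv γ).comp (hS.measurable_curveParam.comp hw)
  exact (hw.sub (ht.smul (measurable_axisFlip.comp (hg.prodMk hv)))).prodMk
    (hg.unitFlip measurable_snd)

theorem bisectorAxis_ne_zero (hS : IsBodyBoundedBy S γ L) (p : Plane) :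
    bisectorAxis S γ L p ≠ 0 := by
  unfold bisectorAxis
  split_ifs with hp
  · exact hS.deriv_ne_zero _
  · exact (hS.tangentPair_spec hp).ne

theorem reflection_bisectorLine (hS : IsBodyBoundedBy S γ L) {p : Plane} (hp : p ∉ interior S)
    (v : Plane) : (bisectorLine S p).reflection v = axisFlip (bisectorAxis S γ L p) v := by
  have h : bisectorLine S p = (Submodule.span ℝ {bisectorAxis S γ L p})ᗮ := by
    unfold bisectorAxis
    split_ifs with hpS
    · obtain ⟨-, he⟩ := hS.curveParam_spec hpS hp
      have := hS.bisectorLine_eq (s := curveParam γ L p) (by rwa [he])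
      rwa [he] at this
    · exact (hS.tangentPair_spec hpS).bisectorLine_eq hS.convex hS.nonempty_interior hpS
  simp only [axisFlip, h]

theorem bisectorMap_bisectorMap (z : Plane × UnitVec) :
    bisectorMap S γ L (bisectorMap S γ L z) = z := by
  simp [bisectorMap, unitFlip_unitFlip]

theorem mapsTo_bisectorMap (hS : IsBodyBoundedBy S γ L) :
    MapsTo (bisectorMap S γ L) (visibilityDomain S) (visibilityDomain S) := by
  rintro ⟨p, v⟩ ⟨hp, hm⟩
  refine ⟨hp, ?_⟩
  by_cases hpS : p ∈ S
  · exact ⟨0, le_rfl, by simpa [bisectorMap] using hpS⟩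
  · simp only [bisectorMap, coe_unitFlip, bisectorAxis, if_neg hpS]
    exact (hS.tangentPair_spec hpS).meets_axisFlip hS.convex hpS
      (ne_zero_of_mem_unit_sphere v) hm

theorem bouncePoint_spec (hS : IsBodyBoundedBy S γ L) {z : Plane × UnitVec}
    (hz : z ∈ visibilityDomain S) :
    curveParam γ L (bouncePoint S z.1 z.2) ∈ Ico 0 L ∧
      γ (curveParam γ L (bouncePoint S z.1 z.2)) = bouncePoint S z.1 z.2 :=
  hS.curveParam_spec (bouncePoint_mem hS.isCompact.isClosed hz.2)
    (bouncePoint_notMem_interior hz.1)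

/-- A ray that first meets the body at `γ s` does not point outwards there. -/
theorem hitTime_mul_side_nonneg (hS : IsBodyBoundedBy S γ L) {p v : Plane} {s e : ℝ}
    (hv : ‖v‖ = 1) (hw : bouncePoint S p v = γ s) (hs : γ s ∉ interior S)
    (he : ∀ x ∈ interior S, 0 < e * det2 (deriv γ s) (x - γ s)) :
    0 ≤ hitTime S p v * (e * det2 (deriv γ s) v) := by
  -- A line missing the interior is tangent, and the determinant vanishes. Otherwise take an
  -- interior point at time `a` after the bounce point: `a > 0` gives the sign directly.
  by_cases hline : ∀ t : ℝ, γ s + t • v ∉ interior S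
  · have := (hS.isTangentDir_iff hs (d := v)).1
      ⟨hv, ⟨0, le_rfl, by simpa using hS.mem s⟩, hline⟩
    rw [this.2, mul_zero, mul_zero]
  · push Not at hline
    obtain ⟨a, ha⟩ := hline
    have h1 := he _ ha
    rw [add_sub_cancel_left, det2_smul_right] at h1
    rw [← hw, bouncePoint_eq, add_assoc, ← add_smul] at ha
    have hw' := hS.mem s
    rw [← hw, bouncePoint_eq] at hw'
    have ht := hitTime_nonneg S p v
    rcases lt_trichotomy a 0 with h | h | h
    -- An interior point between `p` and the bounce point contradicts first arrival. If it lies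
    -- behind `p`, convexity puts `p` in `S`, and the hitting time is zero.
    · rcases le_or_gt 0 (hitTime S p v + a) with h2 | h2
      · have := hitTime_le h2 (interior_subset ha)
        linarith
      · have hp : p ∈ S := by
          have e1 : hitTime S p v / (-a) + -(hitTime S p v + a) / (-a) = 1 := by
            rw [← add_div, div_eq_one_iff_eq (by linarith)]; ring
          have hc := hS.convex (interior_subset ha) hw' (a := hitTime S p v / (-a))
            (b := -(hitTime S p v + a) / (-a)) (div_nonneg ht (by linarith))
            (div_nonneg (by linarith) (by linarith)) e1
          convert hc using 1
          have e2 : hitTime S p v / (-a) * (hitTime S p v + a)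
              + -(hitTime S p v + a) / (-a) * hitTime S p v = 0 := by ring
          rw [smul_add, smul_add, add_add_add_comm, ← add_smul, e1, smul_smul, smul_smul,
            ← add_smul, e2, one_smul, zero_smul, add_zero]
        have h3 : hitTime S p v ≤ 0 := hitTime_le le_rfl (by simpa using hp)
        rw [le_antisymm h3 ht, zero_mul]
    · simp [h] at h1
    · exact mul_nonneg ht (by nlinarith)

/-- The flip preserves `det2 (deriv γ s)`, so the new point is, like the old one, not strictly on
the inner side of the tangent line; its ray reaches the same bounce point. -/
theorem mapsTo_bounceMap (hS : IsBodyBoundedBy S γ L) :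
    MapsTo (bounceMap S γ L) (visibilityDomain S) (visibilityDomain S) := by
  intro z hz
  obtain ⟨h1, h2⟩ := hS.bouncePoint_spec hz
  set s := curveParam γ L (bouncePoint S z.1 z.2) with hsdef
  have hs := (hS.mem_frontier h1).2
  obtain ⟨e, -, -, he⟩ := hS.exists_side hs
  have hnn := hS.hitTime_mul_side_nonneg (norm_eq_of_mem_sphere z.2) h2.symm hs he
  refine ⟨fun hint => ?_, hitTime S z.1 z.2, hitTime_nonneg _ _ _, ?_⟩
  · simp only [bounceMap] at hint
    rw [← hsdef, ← h2] at hint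
    have := he _ hint
    rw [sub_sub_cancel_left, det2_neg_right, det2_smul_right, det2_axisFlip] at this
    linarith
  · simp only [bounceMap, coe_unitFlip, sub_add_cancel]
    exact bouncePoint_mem hS.isCompact.isClosed hz.2

theorem bouncingOuterBilliard_eq (hS : IsBodyBoundedBy S γ L) {z : Plane × UnitVec}
    (hz : z ∈ visibilityDomain S) :
    bouncingOuterBilliard S z = bisectorMap S γ L (bounceMap S γ L z) := by
  obtain ⟨h1, h2⟩ := hS.bouncePoint_spec hz
  have hs := (hS.mem_frontier h1).2
  have hr : reflectedDir S z.1 z.2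
      = -axisFlip (deriv γ (curveParam γ L (bouncePoint S z.1 z.2))) z.2 := by
    have := hS.reflection_tangentLine hs z.2
    rwa [h2] at this
  have hn : nextPoint S z.1 z.2 = (bounceMap S γ L z).1 := by
    rw [nextPoint, dist_bouncePoint (norm_eq_of_mem_sphere z.2), hr, smul_neg, ← sub_eq_add_neg]
    rfl
  refine Prod.ext hn (Subtype.ext ?_)
  change nextDir S z.1 z.2 = _
  have hm : nextPoint S z.1 z.2 ∉ interior S := hn ▸ (hS.mapsTo_bounceMap hz).1
  rw [nextDir, hS.reflection_bisectorLine hm, hn, hr, neg_neg]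
  rfl

end IsBodyBoundedBy

/-! ### Arrival coordinates and the change of variables -/

/-- The parametrization of the rays arriving at a curve `γ`: the pair `(x, v)` is mapped to the ray
with direction `v` that reaches the point `γ (x 0)` at the time `x 1`. -/
noncomputable def rayMap (γ : ℝ → Plane) (z : Plane × UnitVec) : Plane × UnitVec :=
  (γ (z.1 0) - z.1 1 • (z.2 : Plane), z.2)

/-- The reflection of directions in the normal line of `γ` at the parameter `x 0`. -/
noncomputable def rayFlip (γ : ℝ → Plane) (z : Plane × UnitVec) : Plane × UnitVec :=
  (z.1, unitFlip (deriv γ (z.1 0)) z.2)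

/-- The parameters of the rays that arrive at the curve `γ` on `[0, L)` from the side opposite
to `c`. -/
def incomingRays (γ : ℝ → Plane) (L : ℝ) (c : Plane) : Set (Plane × UnitVec) :=
  {z | z.1 0 ∈ Ico 0 L ∧ 0 < z.1 1 ∧
    0 < det2 (deriv γ (z.1 0)) (c - γ (z.1 0)) * det2 (deriv γ (z.1 0)) z.2}

/-- The Jacobian of `rayMap`. -/
noncomputable def rayJacobian (γ : ℝ → Plane) (z : Plane × UnitVec) : ENNReal :=
  ENNReal.ofReal |det2 (deriv γ (z.1 0)) z.2|

/-- The measure `dA ⊗ dθ` in the coordinates given by `rayMap`. -/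
noncomputable def rayMeasure (γ : ℝ → Plane) (L : ℝ) (c : Plane) : Measure (Plane × UnitVec) :=
  (phaseMeasure.restrict (incomingRays γ L c)).withDensity (rayJacobian γ)

theorem rayFlip_mem_incomingRays {γ : ℝ → Plane} {L : ℝ} {c : Plane} {z : Plane × UnitVec} :
    rayFlip γ z ∈ incomingRays γ L c ↔ z ∈ incomingRays γ L c := by
  simp [rayFlip, incomingRays, det2_axisFlip]

theorem rayJacobian_rayFlip (γ : ℝ → Plane) (z : Plane × UnitVec) :
    rayJacobian γ (rayFlip γ z) = rayJacobian γ z := by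
  simp [rayFlip, rayJacobian, det2_axisFlip]

theorem measurable_deriv_coord (γ : ℝ → Plane) :
    Measurable fun z : Plane × UnitVec => deriv γ (z.1 0) :=
  (measurable_deriv γ).comp (by fun_prop)

theorem measurable_det2_deriv (γ : ℝ → Plane) :
    Measurable fun z : Plane × UnitVec => det2 (deriv γ (z.1 0)) z.2 :=
  (measurable_deriv_coord γ).det2 (measurable_subtype_coe.comp measurable_snd)

theorem measurable_rayJacobian (γ : ℝ → Plane) : Measurable (rayJacobian γ) :=
  (measurable_det2_deriv γ).abs.ennreal_ofReal

theorem measurable_rayFlip (γ : ℝ → Plane) : Measurable (rayFlip γ) :=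
  measurable_fst.prodMk ((measurable_deriv_coord γ).unitFlip measurable_snd)

theorem measurable_rayMap {γ : ℝ → Plane} (hγ : Continuous γ) : Measurable (rayMap γ) := by
  unfold rayMap; fun_prop

theorem measurableSet_incomingRays {γ : ℝ → Plane} (hγ : Continuous γ) (L : ℝ) (c : Plane) :
    MeasurableSet (incomingRays γ L c) := by
  have h0 : Measurable fun z : Plane × UnitVec => z.1 0 := by fun_prop
  have h1 : Measurable fun z : Plane × UnitVec => z.1 1 := by fun_prop
  have h2 : Measurable fun z : Plane × UnitVec => c - γ (z.1 0) := by fun_prop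
  exact (measurableSet_Ico.preimage h0).inter ((measurableSet_lt measurable_const h1).inter
    (measurableSet_lt measurable_const
      (((measurable_deriv_coord γ).det2 h2).mul (measurable_det2_deriv γ))))

instance : SFinite phaseMeasure := by unfold phaseMeasure; infer_instance

theorem measurePreserving_rayFlip_phaseMeasure {γ : ℝ → Plane} (h : ∀ s, deriv γ s ≠ 0) :
    MeasurePreserving (rayFlip γ) phaseMeasure phaseMeasure :=
  (MeasurePreserving.id (volume : Measure Plane)).skew_product
    (g := fun x v => unitFlip (deriv γ (x 0)) v)
    ((measurable_deriv_coord γ).unitFlip measurable_snd)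
    (.of_forall fun x => (measurePreserving_unitFlip (h (x 0))).map_eq)

theorem measurePreserving_rayFlip {γ : ℝ → Plane} (hγ : Continuous γ) (h : ∀ s, deriv γ s ≠ 0)
    (L : ℝ) (c : Plane) :
    MeasurePreserving (rayFlip γ) (rayMeasure γ L c) (rayMeasure γ L c) := by
  have hm := measurable_rayFlip γ
  refine ⟨hm, Measure.ext fun B hB => ?_⟩
  have hX := measurableSet_incomingRays hγ L c
  have hmp := (measurePreserving_rayFlip_phaseMeasure h).restrict_preimage hX
  have hpre : rayFlip γ ⁻¹' incomingRays γ L c = incomingRays γ L c :=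
    Set.ext fun z => rayFlip_mem_incomingRays
  rw [hpre] at hmp
  rw [Measure.map_apply hm hB, rayMeasure, withDensity_apply _ (hm hB), withDensity_apply _ hB,
    ← hmp.setLIntegral_comp_preimage hB (measurable_rayJacobian γ)]
  simp only [rayJacobian_rayFlip]

theorem hasFDerivAt_rayMap {γ : ℝ → Plane} (hγ : Differentiable ℝ γ) (v x : Plane) :
    HasFDerivAt (fun y : Plane => γ (y 0) - y 1 • v)
      (((EuclideanSpace.proj 0 : Plane →L[ℝ] ℝ).smulRight (deriv γ (x 0)))
        - (EuclideanSpace.proj 1 : Plane →L[ℝ] ℝ).smulRight v) x := by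
  have h0 : HasFDerivAt (fun y : Plane => y 0) (EuclideanSpace.proj 0 : Plane →L[ℝ] ℝ) x :=
    (EuclideanSpace.proj 0 : Plane →L[ℝ] ℝ).hasFDerivAt
  have h1 : HasFDerivAt (fun y : Plane => y 1) (EuclideanSpace.proj 1 : Plane →L[ℝ] ℝ) x :=
    (EuclideanSpace.proj 1 : Plane →L[ℝ] ℝ).hasFDerivAt
  have := ((hγ (x 0)).hasDerivAt.hasFDerivAt.comp x h0).sub (h1.smul_const v)
  refine this.congr_fderiv ?_
  ext y i
  simp

theorem det_rayMap (g v : Plane) :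
    (((EuclideanSpace.proj 0 : Plane →L[ℝ] ℝ).smulRight g)
        - (EuclideanSpace.proj 1 : Plane →L[ℝ] ℝ).smulRight v).det = -det2 g v := by
  rw [ContinuousLinearMap.det, ← LinearMap.det_toMatrix (EuclideanSpace.basisFun (Fin 2) ℝ).toBasis,
    Matrix.det_fin_two]
  simp [LinearMap.toMatrix_apply, det2]
  ring

/-- The points whose line in direction `v` meets the interior form a convex set `U`. The exceptional
points lie in its frontier, and frontiers of convex sets are null. -/
theorem volume_no_interior_hit {S : Set Plane} (hS : Convex ℝ S) (hi : (interior S).Nonempty)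
    (v : Plane) :
    volume {p : Plane | (∃ t : ℝ, 0 ≤ t ∧ p + t • v ∈ S) ∧ ∀ t : ℝ, p + t • v ∉ interior S} = 0 := by
  set U : Set Plane := {p | ∃ t : ℝ, p + t • v ∈ interior S} with hU
  have hconv : Convex ℝ U := by
    rintro x ⟨a, ha⟩ y ⟨b, hb⟩ α β hα hβ hαβ
    refine ⟨α * a + β * b, ?_⟩
    convert hS.interior ha hb hα hβ hαβ using 1
    module
  refine measure_mono_null ?_ (hconv.addHaar_frontier volume)
  rintro p ⟨⟨t, -, ht⟩, hp⟩
  refine ⟨?_, fun h => ?_⟩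
  · have hcl : p + t • v ∈ closure (interior S) := by
      rw [hS.closure_interior_eq_closure_of_nonempty_interior hi]; exact subset_closure ht
    have hc : Continuous fun y : Plane => y - t • v := by fun_prop
    have := map_mem_closure (t := U) hc hcl fun y hy => ⟨t, by simpa using hy⟩
    simpa using this
  · obtain ⟨u, hu⟩ := interior_subset h
    exact hp u hu

namespace IsBodyBoundedBy

variable {S : Set Plane} {γ : ℝ → Plane} {L : ℝ} {c : Plane}

theorem exists_side_of_mem_incomingRays (hS : IsBodyBoundedBy S γ L) (hc : c ∈ interior S)
    {z : Plane × UnitVec} (hz : z ∈ incomingRays γ L c) :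
    ∃ e : ℝ, 0 < e * det2 (deriv γ (z.1 0)) z.2 ∧
      ∀ x ∈ S, 0 ≤ e * det2 (deriv γ (z.1 0)) (x - γ (z.1 0)) := by
  obtain ⟨e, he, hle, hlt⟩ := hS.exists_side (hS.mem_frontier hz.1).2
  refine ⟨e, ?_, hle⟩
  have h1 := hlt c hc
  have h2 := hz.2.2
  have h3 := mul_pos h1 h2
  -- Both `e` and `det2 (deriv γ _) v` have the sign of the determinant at `c`; multiplying by its
  -- square removes that unknown sign.
  refine pos_of_mul_pos_right (a := det2 (deriv γ (z.1 0)) (c - γ (z.1 0)) ^ 2) ?_ (by positivity)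
  linarith

theorem rayMap_spec (hS : IsBodyBoundedBy S γ L) (hc : c ∈ interior S)
    {z : Plane × UnitVec} (hz : z ∈ incomingRays γ L c) :
    rayMap γ z ∈ visibilityDomain S ∧ hitTime S (rayMap γ z).1 z.2 = z.1 1 ∧
      bouncePoint S (rayMap γ z).1 z.2 = γ (z.1 0) := by
  obtain ⟨e, hv, hle⟩ := hS.exists_side_of_mem_incomingRays hc hz
  have ht := hz.2.1
  have hmem : (rayMap γ z).1 + z.1 1 • (z.2 : Plane) ∈ S := by
    simpa [rayMap] using hS.mem (z.1 0)
  have hside : ∀ u : ℝ, (rayMap γ z).1 + u • (z.2 : Plane) ∈ S → z.1 1 ≤ u := by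
    intro u hu
    have h := hle _ hu
    have e1 : (rayMap γ z).1 + u • (z.2 : Plane) - γ (z.1 0) = (u - z.1 1) • (z.2 : Plane) := by
      simp only [rayMap]; module
    rw [e1, det2_smul_right] at h
    by_contra! hlt
    nlinarith
  have htime : hitTime S (rayMap γ z).1 z.2 = z.1 1 :=
    le_antisymm (hitTime_le ht.le hmem)
      (hside _ (bouncePoint_mem hS.isCompact.isClosed ⟨_, ht.le, hmem⟩))
  refine ⟨⟨fun hp => ?_, _, ht.le, hmem⟩, htime, ?_⟩
  · have := hside 0 (by simpa using interior_subset hp)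
    linarith
  · rw [bouncePoint_eq, htime]; simp [rayMap]

theorem injOn_rayMap (hS : IsBodyBoundedBy S γ L) (hc : c ∈ interior S) :
    InjOn (rayMap γ) (incomingRays γ L c) := by
  intro z hz z' hz' h
  obtain ⟨-, h1, h2⟩ := hS.rayMap_spec hc hz
  obtain ⟨-, h1', h2'⟩ := hS.rayMap_spec hc hz'
  have hv : z.2 = z'.2 := show (rayMap γ z).2 = (rayMap γ z').2 by rw [h]
  refine Prod.ext (plane_ext (hS.injOn hz.1 hz'.1 ?_) ?_) hv
  · rw [← h2, ← h2', h, hv]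
  · rw [← h1, ← h1', h, hv]

theorem bounceMap_rayMap (hS : IsBodyBoundedBy S γ L) (hc : c ∈ interior S)
    {z : Plane × UnitVec} (hz : z ∈ incomingRays γ L c) :
    bounceMap S γ L (rayMap γ z) = rayMap γ (rayFlip γ z) := by
  obtain ⟨-, h1, h2⟩ := hS.rayMap_spec hc hz
  change (_, _) = (_, _)
  rw [show (rayMap γ z).2 = z.2 from rfl, h1, h2, hS.curveParam_apply hz.1]
  rfl

/-- Since `p ∉ S`, the hitting time is positive, and since the line enters the interior, the arrival
is transversal. These are the strict inequalities that define `incomingRays`. -/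
theorem mem_image_rayMap (hS : IsBodyBoundedBy S γ L) (hc : c ∈ interior S)
    {z : Plane × UnitVec} (hz : z ∈ visibilityDomain S) (hp : z.1 ∉ S)
    (hint : ∃ t : ℝ, z.1 + t • (z.2 : Plane) ∈ interior S) :
    z ∈ rayMap γ '' incomingRays γ L c := by
  obtain ⟨h1, h2⟩ := hS.bouncePoint_spec hz
  have hs := (hS.mem_frontier h1).2
  set s := curveParam γ L (bouncePoint S z.1 z.2)
  obtain ⟨e, -, -, he⟩ := hS.exists_side hs
  have hnn := hS.hitTime_mul_side_nonneg (norm_eq_of_mem_sphere z.2) h2.symm hs he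
  have hpos : 0 < hitTime S z.1 z.2 := by
    refine (hitTime_nonneg _ _ _).lt_of_ne fun h0 => hp ?_
    have := bouncePoint_mem hS.isCompact.isClosed hz.2
    rwa [bouncePoint_eq, ← h0, zero_smul, add_zero] at this
  have hnn' := nonneg_of_mul_nonneg_right hnn hpos
  obtain ⟨t, ht⟩ := hint
  have h3 := he _ ht
  have e1 : z.1 + t • (z.2 : Plane) - γ s = (t - hitTime S z.1 z.2) • (z.2 : Plane) := by
    rw [h2, bouncePoint_eq]; module
  rw [e1, det2_smul_right] at h3
  have hne : e * det2 (deriv γ s) z.2 ≠ 0 := fun h0 => by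
    rw [mul_left_comm, h0, mul_zero] at h3
    exact h3.false
  have h4 := mul_pos (hnn'.lt_of_ne hne.symm) (he c hc)
  refine ⟨(!₂[s, hitTime S z.1 z.2], z.2), ⟨by simpa using h1, by simpa using hpos, ?_⟩, ?_⟩
  · refine pos_of_mul_pos_right (a := e ^ 2) ?_ (by positivity)
    simp only [Matrix.cons_val_zero]
    linarith
  · refine Prod.ext ?_ rfl
    simp only [rayMap, Matrix.cons_val_zero, Matrix.cons_val_one, h2, bouncePoint_eq]
    module

/-- The area formula for the injective map `(s, t) ↦ γ s - t • v` at fixed `v`. Its image misses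
only points of the frontier and points whose line avoids the interior, both null sets. -/
theorem volume_slice (hS : IsBodyBoundedBy S γ L) (hc : c ∈ interior S) {B : Set (Plane × UnitVec)}
    (hB : MeasurableSet B) (v : UnitVec) :
    volume {p : Plane | (p, v) ∈ visibilityDomain S ∩ B}
      = ∫⁻ x in {x | (x, v) ∈ incomingRays γ L c ∩ rayMap γ ⁻¹' B}, rayJacobian γ (x, v) := by
  have hcont := hS.differentiable.continuous
  set Y : Set Plane := {x | (x, v) ∈ incomingRays γ L c ∩ rayMap γ ⁻¹' B} with hY
  have hYm : MeasurableSet Y :=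
    ((measurableSet_incomingRays hcont L c).inter (measurable_rayMap hcont hB)).preimage
      measurable_prodMk_right
  have hinj : InjOn (fun y : Plane => γ (y 0) - y 1 • (v : Plane)) Y := by
    intro x hx y hy h
    exact congrArg Prod.fst (hS.injOn_rayMap hc hx.1 hy.1 (Prod.ext h rfl))
  have himg := lintegral_abs_det_fderiv_eq_addHaar_image volume hYm
    (fun x _ => (hasFDerivAt_rayMap hS.differentiable (v : Plane) x).hasFDerivWithinAt) hinj
  simp only [det_rayMap, abs_neg] at himg
  refine Eq.trans ?_ himg.symm
  refine le_antisymm ?_ (measure_mono ?_)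
  · have hnull : volume (frontier S ∪ {p : Plane | (∃ t : ℝ, 0 ≤ t ∧ p + t • (v : Plane) ∈ S) ∧
        ∀ t : ℝ, p + t • (v : Plane) ∉ interior S}) = 0 :=
      measure_union_null (hS.convex.addHaar_frontier volume)
        (volume_no_interior_hit hS.convex hS.nonempty_interior v)
    refine (measure_mono (?_ : _ ⊆ (fun y : Plane => γ (y 0) - y 1 • (v : Plane)) '' Y ∪ _)).trans
      ((measure_union_le _ _).trans_eq (by rw [hnull, add_zero]))
    rintro p ⟨hp, hpB⟩
    by_cases hpS : p ∈ S
    · refine .inr (.inl ?_)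
      rw [hS.isCompact.isClosed.frontier_eq]
      exact ⟨hpS, hp.1⟩
    by_cases hint : ∃ t : ℝ, p + t • (v : Plane) ∈ interior S
    · obtain ⟨⟨x, v'⟩, hx, hxe⟩ := hS.mem_image_rayMap hc hp hpS hint
      obtain rfl : v' = v := congrArg Prod.snd hxe
      refine .inl ⟨x, ⟨hx, ?_⟩, congrArg Prod.fst hxe⟩
      rwa [mem_preimage, hxe]
    · push Not at hint
      exact .inr (.inr ⟨hp.2, hint⟩)
  · rintro _ ⟨x, ⟨hx, hxB⟩, rfl⟩
    exact ⟨(hS.rayMap_spec hc hx).1, hxB⟩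

theorem phaseMeasure_inter (hS : IsBodyBoundedBy S γ L) (hc : c ∈ interior S)
    {B : Set (Plane × UnitVec)} (hB : MeasurableSet B) :
    phaseMeasure (visibilityDomain S ∩ B) = rayMeasure γ L c (rayMap γ ⁻¹' B) := by
  have hcont := hS.differentiable.continuous
  have hV := measurableSet_visibilityDomain hS.isCompact.isClosed
  have hP := measurable_rayMap hcont hB
  have hX := measurableSet_incomingRays hcont L c
  have hXB := hX.inter hP
  rw [phaseMeasure, Measure.prod_apply_symm (hV.inter hB), rayMeasure, withDensity_apply _ hP,
    Measure.restrict_restrict hP, inter_comm (rayMap γ ⁻¹' B), ← lintegral_indicator hXB,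
    phaseMeasure, lintegral_prod_symm _
      ((measurable_rayJacobian γ).indicator hXB).aemeasurable]
  refine lintegral_congr fun v => ?_
  refine (hS.volume_slice hc hB v).trans ?_
  exact (lintegral_indicator (hXB.preimage measurable_prodMk_right) _).symm

end IsBodyBoundedBy

/-! ### Infinite total mass -/

theorem circleMeasure_univ_ne_zero : circleMeasure univ ≠ 0 := by
  rw [circleMeasure, Measure.map_apply continuous_unitVec.measurable .univ]
  simp [Real.pi_pos]

theorem volume_visible_eq_top {S : Set Plane} (hS : IsCompact S) (hi : (interior S).Nonempty)
    (v : UnitVec) : volume {p : Plane | (p, v) ∈ visibilityDomain S} = ⊤ := by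
  obtain ⟨c, hc⟩ := hi
  obtain ⟨ε, hε, hball⟩ := Metric.isOpen_iff.1 isOpen_interior c hc
  obtain ⟨R, hR⟩ := hS.isBounded.subset_closedBall c
  have hR0 : 0 ≤ R := dist_nonneg.trans (hR (interior_subset hc))
  have hv : ‖(v : Plane)‖ = 1 := norm_eq_of_mem_sphere v
  -- Steps of `2ε` make the balls of radius `ε` disjoint, and the offset keeps them outside the ball
  -- of radius `R` containing `S`. Translation by `r n • v` carries each into the `ε`-ball around
  -- `c`.
  set r : ℕ → ℝ := fun n => R + 2 * ε * (n + 1) with hr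
  set b : ℕ → Set Plane := fun n => Metric.ball (c - r n • (v : Plane)) ε
  have hdisj : Pairwise (Function.onFun Disjoint b) := by
    intro m n hmn
    refine Metric.ball_disjoint_ball ?_
    rw [dist_sub_left, dist_eq_norm, ← sub_smul, norm_smul, hv, mul_one, Real.norm_eq_abs,
      show r m - r n = 2 * ε * ((m : ℝ) - n) by simp only [hr]; ring, abs_mul,
      abs_of_pos (by positivity)]
    have h1 : (1 : ℝ) ≤ |(m : ℝ) - n| := by
      have : (1 : ℤ) ≤ |(m : ℤ) - n| := Int.one_le_abs (sub_ne_zero.2 (by exact_mod_cast hmn))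
      exact_mod_cast this
    nlinarith
  have hsub : ⋃ n, b n ⊆ {p : Plane | (p, v) ∈ visibilityDomain S} := by
    refine iUnion_subset fun n p hp => ?_
    have hrn : R + ε < r n := by
      simp only [hr]
      have : (0 : ℝ) ≤ n := n.cast_nonneg
      nlinarith
    have hp' : dist p (c - r n • (v : Plane)) < ε := hp
    refine ⟨fun h => ?_, r n, by linarith, interior_subset (hball ?_)⟩
    · have h1 : dist p c ≤ R := hR (interior_subset h)
      have h2 : dist c (c - r n • (v : Plane)) = r n := by
        rw [dist_self_sub_right, norm_smul, hv, mul_one, Real.norm_of_nonneg (by linarith)]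
      have h3 := dist_triangle c p (c - r n • (v : Plane))
      rw [dist_comm c p] at h3
      linarith
    · rw [Metric.mem_ball, dist_eq_norm] at *
      rwa [sub_sub_eq_add_sub] at hp'
  refine top_le_iff.1 (le_trans (le_of_eq ?_) (measure_mono hsub))
  rw [measure_iUnion hdisj fun n => Metric.isOpen_ball.measurableSet]
  simp only [b, Measure.addHaar_ball_center]
  exact (ENNReal.tsum_const_eq_top_of_ne_zero (Metric.measure_ball_pos volume 0 hε).ne').symm

theorem phaseMeasure_visibilityDomain {S : Set Plane} (hS : IsCompact S)
    (hi : (interior S).Nonempty) : phaseMeasure (visibilityDomain S) = ⊤ := by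
  rw [phaseMeasure, Measure.prod_apply_symm (measurableSet_visibilityDomain hS.isClosed)]
  have h : ∀ v : UnitVec, volume ((fun x => (x, v)) ⁻¹' visibilityDomain S) = ⊤ :=
    volume_visible_eq_top hS hi
  simp only [h, lintegral_const]
  exact ENNReal.top_mul circleMeasure_univ_ne_zero

/-! ### Invariance of the measure -/

/-- A map that preserves the restriction of a measure to an invariant set `V` preserves the induced
measure on the subtype `V`. -/
theorem measurePreserving_mapsTo_restrict {α : Type*} [MeasurableSpace α] {μ : Measure α}
    {V : Set α} (hV : MeasurableSet V) {T : α → α} (hT : MapsTo T V V)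
    (hm : MeasurePreserving T (μ.restrict V) (μ.restrict V)) :
    MeasurePreserving (hT.restrict T V V) (μ.comap Subtype.val) (μ.comap Subtype.val) := by
  have hr : Measurable (hT.restrict T V V) :=
    (hm.measurable.comp measurable_subtype_coe).subtype_mk
  have he := MeasurableEmbedding.subtype_coe hV
  refine ⟨hr, Measure.ext fun B hB => ?_⟩
  have hB' := he.measurableSet_image.2 hB
  have hsub : Subtype.val '' B ⊆ V := Subtype.coe_image_subset V B
  rw [Measure.map_apply hr hB, he.comap_apply, he.comap_apply,
    ← Measure.restrict_eq_self μ hsub, ← hm.measure_preimage hB'.nullMeasurableSet,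
    Measure.restrict_apply (hm.measurable hB')]
  congr 1
  ext x
  constructor
  · rintro ⟨y, hy, rfl⟩
    exact ⟨⟨_, hy, rfl⟩, y.2⟩
  · rintro ⟨⟨y, hy, hyx⟩, hx⟩
    refine ⟨⟨x, hx⟩, ?_, rfl⟩
    have : hT.restrict T V V ⟨x, hx⟩ = y := Subtype.ext hyx.symm
    rwa [mem_preimage, this]

namespace IsBodyBoundedBy

variable {S : Set Plane} {γ : ℝ → Plane} {L : ℝ}

theorem measurePreserving_bounceMap (hS : IsBodyBoundedBy S γ L) :
    MeasurePreserving (bounceMap S γ L) (phaseMeasure.restrict (visibilityDomain S))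
      (phaseMeasure.restrict (visibilityDomain S)) := by
  have hm := hS.measurable_bounceMap
  obtain ⟨c, hc⟩ := hS.nonempty_interior
  have hcont := hS.differentiable.continuous
  have hX := measurableSet_incomingRays hcont L c
  refine ⟨hm, Measure.ext fun B hB => ?_⟩
  have hΦ := measurable_rayMap hcont
  have hρ := measurePreserving_rayFlip hcont hS.deriv_ne_zero L c
  -- The conjugation of `bounceMap` to `rayFlip` holds only on `incomingRays`, which has full
  -- measure.
  have hae : ∀ᵐ z ∂rayMeasure γ L c, z ∈ incomingRays γ L c :=
    (withDensity_absolutelyContinuous _ _).ae_le (ae_restrict_mem hX)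
  rw [Measure.map_apply hm hB, Measure.restrict_apply (hm hB), Measure.restrict_apply hB,
    inter_comm, inter_comm B, hS.phaseMeasure_inter hc (hm hB), hS.phaseMeasure_inter hc hB,
    ← hρ.measure_preimage (hΦ hB).nullMeasurableSet]
  refine measure_congr (hae.mono fun z hz => ?_)
  change (bounceMap S γ L (rayMap γ z) ∈ B) = (rayMap γ (rayFlip γ z) ∈ B)
  rw [hS.bounceMap_rayMap hc hz]

theorem measurePreserving_bisectorMap (hS : IsBodyBoundedBy S γ L) :
    MeasurePreserving (bisectorMap S γ L) (phaseMeasure.restrict (visibilityDomain S))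
      (phaseMeasure.restrict (visibilityDomain S)) := by
  have hm := hS.measurable_bisectorMap
  have hp : MeasurePreserving (bisectorMap S γ L) phaseMeasure phaseMeasure :=
    (MeasurePreserving.id (volume : Measure Plane)).skew_product
      (g := fun p v => unitFlip (bisectorAxis S γ L p) v)
      ((hS.measurable_bisectorAxis.comp measurable_fst).unitFlip measurable_snd)
      (.of_forall fun p => (measurePreserving_unitFlip (hS.bisectorAxis_ne_zero p)).map_eq)
  -- An involution that maps the domain into itself has it as its own preimage.
  have hpre : bisectorMap S γ L ⁻¹' visibilityDomain S = visibilityDomain S := by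
    refine Subset.antisymm (fun z hz => ?_) fun z hz => hS.mapsTo_bisectorMap hz
    have := hS.mapsTo_bisectorMap hz
    rwa [bisectorMap_bisectorMap] at this
  have := hp.restrict_preimage (measurableSet_visibilityDomain hS.isCompact.isClosed)
  rwa [hpre] at this

end IsBodyBoundedBy

theorem mainTheorem5 (S : Set Plane) (hcompact : IsCompact S) (hconvex : Convex ℝ S)
    (hinterior : (interior S).Nonempty) (hboundary : IsSimpleClosedC2Curve (frontier S)) :
    ∃ hF : MapsTo (bouncingOuterBilliard S) (visibilityDomain S) (visibilityDomain S),
      visibilityMeasure S univ = ⊤ ∧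
      MeasurePreserving
        (hF.restrict (bouncingOuterBilliard S) (visibilityDomain S) (visibilityDomain S))
        (visibilityMeasure S) (visibilityMeasure S) := by
  obtain ⟨γ, L, hL, hγ, hper, hinj, hne, hrange⟩ := hboundary
  have hV := measurableSet_visibilityDomain hcompact.isClosed
  have hS : IsBodyBoundedBy S γ L :=
    { isCompact := hcompact
      convex := hconvex
      nonempty_interior := hinterior
      differentiable := hγ.differentiable (by norm_num)
      injOn := hinj
      deriv_ne_zero := hne
      mem := fun s => hcompact.isClosed.frontier_subset (hrange ▸ mem_range_self s)
      image_eq := by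
        rw [← hrange]
        refine Subset.antisymm (image_subset_range _ _) ?_
        rintro _ ⟨s, rfl⟩
        obtain ⟨t, ht, h⟩ := hper.exists_mem_Ico₀ hL s
        exact ⟨t, ht, h.symm⟩ }
  have hmaps : MapsTo (bisectorMap S γ L ∘ bounceMap S γ L) (visibilityDomain S)
      (visibilityDomain S) := hS.mapsTo_bisectorMap.comp hS.mapsTo_bounceMap
  have heq : EqOn (bisectorMap S γ L ∘ bounceMap S γ L) (bouncingOuterBilliard S)
      (visibilityDomain S) := fun z hz => (hS.bouncingOuterBilliard_eq hz).symm
  refine ⟨hmaps.congr heq, ?_, ?_⟩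
  · rw [visibilityMeasure, (MeasurableEmbedding.subtype_coe hV).comap_apply, image_univ,
      Subtype.range_coe, phaseMeasure_visibilityDomain hcompact hinterior]
  · have h := measurePreserving_mapsTo_restrict hV hmaps
      (hS.measurePreserving_bisectorMap.comp hS.measurePreserving_bounceMap)
    have he : (hmaps.congr heq).restrict (bouncingOuterBilliard S) (visibilityDomain S)
        (visibilityDomain S) = hmaps.restrict _ _ _ :=
      funext fun z => Subtype.ext (heq z.2).symm
    rw [he]
    exact h
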